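/- Let $d\ge 1$, and let $\phi:(0,\infty)\to(0,\infty)$ be a complete Bernstein function, i.e. $$\phi(\lambda)=a+b\lambda+\int_0^\infty (1-e^{-\lambda t})\,\mu(t)\,dt,\qquad \lambda>0,$$ with $a,b\ge 0$ and $\mu$ a completely monotone function on $(0,\infty)$ such that $\int_0^\infty (1\wedge t)\mu(t)\,dt<\infty$. Assume: **(H1)** there are constants $0<\delta_1\le\delta_2<1$ and $a_1,a_2>0$ such that $a_1 (R/r)^{\delta_1}\le \phi(R)/\phi(r)\le a_2 (R/r)^{\delta_2}$ for all $1\le r\le R$; **(H2)** there are constants $0<\delta_3\le\delta_4<1$ and $a_3,a_4>0$ such that $a_3 (R/r)^{\delta_3}\le \phi(R)/\phi(r)\le a_4 (R/r)^{\delta_4}$ for all $0<r\le R\le 1$. Let $S$ be a subordinator with Laplace exponent $\phi$, that is, an increasing Lévy process with $S_0=0$ and $\mathbb E[e^{-\lambda S_t}]=e^{-t\phi(\lambda)}$. Let $W$ be a Brownian motion in $\mathbb R^d$ started at $0$, independent of $S$, with $\mathbb E[e^{i\xi\cdot W_t}]=e^{-t|\xi|^2}$. Let $X_t=W(S_t)$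 be the subordinate Brownian motion, and let $q(t,x)=(4\pi t)^{-d/2}e^{-|x|^2/(4t)}$. (a) The Lévy measure of $X$ has the density $J(x)=\int_0^\infty q(t,x)\,\mu(t)\,dt$ with respect to Lebesgue measure, and there is a constant $c\ge 1$ such that $$c^{-1}|x|^{-d}\phi(|x|^{-2})\le J(x)\le c\,|x|^{-d}\phi(|x|^{-2})\qquad\text{for all }x\ne 0.$$ (b) If $d>2(\delta_2\vee\delta_4)$, then $X$ is transient, i.e. $\mathbb E\int_0^\infty 1_{\{X_t\in K\}}\,dt<\infty$ for every compact $K\subset\mathbb R^d$. Moreover, the mean occupation measure $A\mapsto \mathbb E\int_0^\infty 1_{\{X_t\in A\}}\,dt$ has as its density with respect to Lebesgue measure the Green function $G(x)=\int_0^\infty p(t,x)\,dt$, where $p(t,x)=\int_{(0,\infty)} q(s,x)\,\mathbb P(S_t\in ds)$ is the transition density of $X$, and there is a constant $c\ge 1$ such that $$c^{-1}|x|^{-d}\phi(|x|^{-2})^{-1}\le G(x)\le c\,|x|^{-d}\phi(|x|^{-2})^{-1}\qquad\text{for all }x\ne 0.$$ -/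

import Mathlib

open MeasureTheory ProbabilityTheory Set Filter Topology
open scoped NNReal ENNReal RealInnerProductSpace

namespace SubBM

/-! ### Complete Bernstein functions and scaling conditions -/

/-- `f` is completely monotone on `(0, ∞)`. -/
def CompletelyMonotone (f : ℝ → ℝ) : Prop :=
  ContDiffOn ℝ ((⊤ : ℕ∞) : WithTop ℕ∞) f (Ioi 0) ∧
    ∀ n : ℕ, ∀ t : ℝ, 0 < t → 0 ≤ (-1 : ℝ) ^ n * iteratedDerivWithin n f (Ioi 0) t

/-- `φ : (0, ∞) → (0, ∞)` is a complete Bernstein function with killing term `a`, drift `b` and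
(completely monotone) Lévy density `m`. Values of `φ` and `m` outside `(0, ∞)` play no role. -/
structure IsCompleteBernstein (φ : ℝ → ℝ) (a b : ℝ) (m : ℝ → ℝ) : Prop where
  pos : ∀ l : ℝ, 0 < l → 0 < φ l
  killing_nonneg : 0 ≤ a
  drift_nonneg : 0 ≤ b
  completelyMonotone : CompletelyMonotone m
  integrable : IntegrableOn (fun t => min 1 t * m t) (Ioi 0)
  representation : ∀ l : ℝ, 0 < l →
    φ l = a + b * l + ∫ t in Ioi (0 : ℝ), (1 - Real.exp (-(l * t))) * m t

/-- Scaling of `φ` at infinity, with exponents `δ₁ ≤ δ₂` in `(0, 1)`. -/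
structure ScalingAtInfinity (φ : ℝ → ℝ) (δ₁ δ₂ a₁ a₂ : ℝ) : Prop where
  exponent_pos : 0 < δ₁
  exponent_le : δ₁ ≤ δ₂
  exponent_lt_one : δ₂ < 1
  lower_const_pos : 0 < a₁
  upper_const_pos : 0 < a₂
  lower : ∀ r R : ℝ, 1 ≤ r → r ≤ R → a₁ * (R / r) ^ δ₁ ≤ φ R / φ r
  upper : ∀ r R : ℝ, 1 ≤ r → r ≤ R → φ R / φ r ≤ a₂ * (R / r) ^ δ₂

/-- Scaling of `φ` at zero, with exponents `δ₃ ≤ δ₄` in `(0, 1)`. -/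
structure ScalingAtZero (φ : ℝ → ℝ) (δ₃ δ₄ a₃ a₄ : ℝ) : Prop where
  exponent_pos : 0 < δ₃
  exponent_le : δ₃ ≤ δ₄
  exponent_lt_one : δ₄ < 1
  lower_const_pos : 0 < a₃
  upper_const_pos : 0 < a₄
  lower : ∀ r R : ℝ, 0 < r → r ≤ R → R ≤ 1 → a₃ * (R / r) ^ δ₃ ≤ φ R / φ r
  upper : ∀ r R : ℝ, 0 < r → r ≤ R → R ≤ 1 → φ R / φ r ≤ a₄ * (R / r) ^ δ₄

/-! ### Processes -/

section Processes

variable {Ω : Type*} [MeasurableSpace Ω]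

/-- `X` is a Lévy process started at `0`, with almost surely càdlàg paths. -/
structure IsLevyProcess {E : Type*} [NormedAddCommGroup E] [MeasurableSpace E]
    (P : Measure Ω) (X : ℝ≥0 → Ω → E) : Prop where
  measurable : ∀ t, Measurable (X t)
  start : ∀ᵐ ω ∂P, X 0 ω = 0
  indepIncrements : HasIndepIncrements X P
  stationaryIncrements : ∀ s t : ℝ≥0, IdentDistrib (fun ω => X (s + t) ω - X s ω) (X t) P P
  cadlag : ∀ᵐ ω ∂P, ∀ t : ℝ≥0, ContinuousWithinAt (fun s => X s ω) (Ici t) t ∧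
    ∃ l : E, Tendsto (fun s => X s ω) (𝓝[<] t) (𝓝 l)

/-- `S` is a subordinator (an increasing Lévy process) with Laplace exponent `φ`. -/
structure IsSubordinator (P : Measure Ω) (S : ℝ≥0 → Ω → ℝ≥0) (φ : ℝ → ℝ) : Prop where
  levy : IsLevyProcess P (fun t ω => (S t ω : ℝ))
  monotone : ∀ᵐ ω ∂P, Monotone (fun t => S t ω)
  laplace : ∀ (t : ℝ≥0) (l : ℝ), 0 < l →
    ∫ ω, Real.exp (-(l * (S t ω : ℝ))) ∂P = Real.exp (-((t : ℝ) * φ l))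

/-- `W` is a Brownian motion in `ℝ^d` started at `0`, run at twice the usual speed:
`𝔼 exp(i ξ · W_t) = exp(-t |ξ|²)`. -/
structure IsBrownianMotion {d : ℕ} (P : Measure Ω)
    (W : ℝ≥0 → Ω → EuclideanSpace ℝ (Fin d)) : Prop where
  levy : IsLevyProcess P W
  continuous : ∀ᵐ ω ∂P, Continuous (fun t => W t ω)
  charFun_eq : ∀ (t : ℝ≥0) (ξ : EuclideanSpace ℝ (Fin d)),
    charFun (P.map (W t)) ξ = Complex.exp (-((t : ℂ) * (‖ξ‖ : ℂ) ^ 2))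

/-- The process `X_t = W(S_t)`. -/
def subordinate {E : Type*} (W : ℝ≥0 → Ω → E) (S : ℝ≥0 → Ω → ℝ≥0) : ℝ≥0 → Ω → E :=
  fun t ω => W (S t ω) ω

/-- `ν` is the Lévy measure of the Lévy process `X`, i.e. the jump measure in the
Lévy–Khintchine formula (with some drift `γ` and some Gaussian covariance operator `Q`). -/
def IsLevyMeasure {E : Type*} [NormedAddCommGroup E] [InnerProductSpace ℝ E] [CompleteSpace E]
    [MeasurableSpace E] (P : Measure Ω) (X : ℝ≥0 → Ω → E) (ν : Measure E) : Prop :=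
  ν {0} = 0 ∧ ∫⁻ x, ENNReal.ofReal (min 1 (‖x‖ ^ 2)) ∂ν < ∞ ∧
    ∃ (γ : E) (Q : E →L[ℝ] E), Q.IsPositive ∧ ∀ (t : ℝ≥0) (ξ : E),
      charFun (P.map (X t)) ξ = Complex.exp ((t : ℂ) *
        (Complex.I * (⟪γ, ξ⟫ : ℂ) - (⟪Q ξ, ξ⟫ : ℂ) / 2 +
          ∫ x, (Complex.exp (Complex.I * (⟪x, ξ⟫ : ℂ)) - 1 -
            Complex.I * (((Metric.closedBall (0 : E) 1).indicator (fun y => ⟪y, ξ⟫) x : ℝ) : ℂ))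
            ∂ν))

/-- The mean time that `X` spends in `A`. -/
noncomputable def meanOccupationTime {E : Type*} (P : Measure Ω) (X : ℝ≥0 → Ω → E)
    (A : Set E) : ℝ≥0∞ :=
  ∫⁻ ω, volume {t : ℝ | 0 ≤ t ∧ X t.toNNReal ω ∈ A} ∂P

/-- A Lévy process is transient if its mean occupation (potential) measure is Radon, that is,
finite on compact sets. -/
def IsTransient {E : Type*} [TopologicalSpace E] (P : Measure Ω) (X : ℝ≥0 → Ω → E) : Prop :=
  ∀ K : Set E, IsCompact K → meanOccupationTime P X K < ∞

/-! ### Lévy density and Green function of subordinate Brownian motion -/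

/-- The transition density `q(t, 0, x) = (4πt)^{-d/2} exp(-|x|²/(4t))` of the Brownian motion. -/
noncomputable def heatKernel (d : ℕ) (t : ℝ) (x : EuclideanSpace ℝ (Fin d)) : ℝ :=
  (4 * Real.pi * t) ^ (-((d : ℝ) / 2)) * Real.exp (-(‖x‖ ^ 2 / (4 * t)))

/-- `J(x) = j(|x|) = ∫_0^∞ (4πt)^{-d/2} exp(-|x|²/(4t)) m(t) dt`, where `m` is the Lévy density
of the subordinator. -/
noncomputable def jumpDensity (d : ℕ) (m : ℝ → ℝ) (x : EuclideanSpace ℝ (Fin d)) : ℝ≥0∞ :=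
  ∫⁻ t in Ioi (0 : ℝ), ENNReal.ofReal (heatKernel d t x * m t)

/-- The transition density `p(t, 0, x) = ∫_{(0,∞)} q(s, 0, x) ℙ(S_t ∈ ds)` of `X`. -/
noncomputable def transitionDensity (d : ℕ) (P : Measure Ω) (S : ℝ≥0 → Ω → ℝ≥0) (t : ℝ≥0)
    (x : EuclideanSpace ℝ (Fin d)) : ℝ≥0∞ :=
  ∫⁻ s in Ioi (0 : ℝ), ENNReal.ofReal (heatKernel d s x) ∂(P.map (fun ω => (S t ω : ℝ)))

/-- The Green function `G(x) = G(0, x) = ∫_0^∞ p(t, 0, x) dt` of `X`. -/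
noncomputable def greenFunction (d : ℕ) (P : Measure Ω) (S : ℝ≥0 → Ω → ℝ≥0)
    (x : EuclideanSpace ℝ (Fin d)) : ℝ≥0∞ :=
  ∫⁻ t in Ioi (0 : ℝ), transitionDensity d P S t.toNNReal x

end Processes

/-- `f(x) ≍ h(x)` for all `x ≠ 0`. -/
def ComparableOffZero {E : Type*} [Zero E] (f : E → ℝ≥0∞) (h : E → ℝ) : Prop :=
  ∃ c : ℝ, 1 ≤ c ∧ ∀ x : E, x ≠ 0 →
    ENNReal.ofReal (c⁻¹ * h x) ≤ f x ∧ f x ≤ ENNReal.ofReal (c * h x)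

end SubBM

namespace SubBM

/-! ### Elementary inequalities for `1 - exp (-y)` -/

/-! The two scaling conditions glue at 1 into power bounds on all of `(0, ∞)`, with a lower exponent
`δ > 0` and an upper exponent `δ' < 1`. Letting the argument tend to 0 and to infinity, these force
`a = b = 0`, so `φ` is the pure integral of `1 - exp (-(l * t))` against the Lévy density `m`, and
that kernel is comparable with `min 1 (l * t)`.

Jump density. The Gaussian kernel is at most a constant times `|x|^(-d) min(1, t/|x|²)`, so
integrating against `m` gives the upper bound at once. The lower bound comes from times `t ≈ |x|²`
and needs `t m(t) ≥ c φ(1/t)` (`exists_density_lower_bound`): scaling makes the contribution of very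
small and very large jumps to `φ(1/t)` negligible, and monotonicity of `m` controls the middle
range. That `J` is the Lévy density follows from Tonelli: integrating `1 - cos⟪x, ξ⟫` against `J`
gives `φ(|ξ|²)`, which is the exponent of `X`, since conditioning on the independent time `S_t`
gives `E exp(-|ξ|² S_t)`.

Green function. The potential measure `U` of `S` has Laplace transform `1/φ`, and `G` is the
Gaussian kernel integrated against `U`. Both bounds use this transform only, without any density for
`U`. From above, `min(ρ, 1/s)^p` is dominated by an integral of `l^(p-1) exp(-ls)` over `0 < l ≤ ρ`,
which reduces the estimate to integrating `l^(p-1)/φ(l)`; this converges at 0 because `p = d/2 > δ'`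
(`lintegral_min_rpow_le`). From below, `exp(-s/|x|²)` is dominated by the kernel plus two
exponentials whose total `U`-integral is at most half of the left side
(`exists_le_potentialDensity`). Uniqueness of characteristic functions identifies the law of `X_t`,
and Tonelli gives the occupation density. -/

lemma one_sub_exp_neg_nonneg {y : ℝ} (hy : 0 ≤ y) : 0 ≤ 1 - Real.exp (-y) := by
  have := Real.exp_le_one_iff.2 (neg_nonpos.2 hy)
  linarith

lemma one_sub_exp_neg_le_min (y : ℝ) : 1 - Real.exp (-y) ≤ min 1 y := by
  have h1 := Real.exp_pos (-y)
  have h2 := Real.add_one_le_exp (-y)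
  exact le_min (by linarith) (by linarith)

/-- From `exp y ≥ 1 + y` one gets `1 - exp (-y) ≥ y / (1 + y)`. Together with
`one_sub_exp_neg_le_min` this lets truncations and exponentials be exchanged freely. -/
lemma min_one_le_two_mul_one_sub_exp_neg {y : ℝ} (hy : 0 ≤ y) :
    min 1 y ≤ 2 * (1 - Real.exp (-y)) := by
  have h1 := Real.add_one_le_exp y
  have h2 : Real.exp (-y) ≤ 1 / (1 + y) := by
    rw [Real.exp_neg, ← one_div]
    exact one_div_le_one_div_of_le (by linarith) (by linarith)
  have h3 : y / (1 + y) ≤ 1 - Real.exp (-y) := by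
    have : y / (1 + y) = 1 - 1 / (1 + y) := by field_simp; ring
    linarith
  have h4 : min 1 y ≤ 2 * (y / (1 + y)) := by
    rw [← mul_div_assoc, le_div_iff₀ (by linarith)]
    rcases le_total y 1 with h | h
    · rw [min_eq_right h]; nlinarith
    · rw [min_eq_left h]; nlinarith
  linarith

/-- Bernoulli's inequality for `(exp (-y)) ^ c`. It yields the sublinear growth of `φ` in
`map_mul_le`, which holds without any scaling hypothesis. -/
lemma one_sub_exp_neg_mul_le {c y : ℝ} (hc : 1 ≤ c) :
    1 - Real.exp (-(c * y)) ≤ c * (1 - Real.exp (-y)) := by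
  have h := one_add_mul_self_le_rpow_one_add (s := Real.exp (-y) - 1)
    (by linarith [Real.exp_pos (-y)]) hc
  have h2 : (1 + (Real.exp (-y) - 1)) ^ c = Real.exp (-(c * y)) := by
    rw [add_sub_cancel, ← Real.exp_mul]; ring_nf
  rw [h2] at h
  linarith

lemma rpow_mul_exp_neg_le {p : ℝ} (hp : 0 < p) {y : ℝ} (hy : 0 ≤ y) :
    y ^ p * Real.exp (-y) ≤ p ^ p := by
  have h1 : y ≤ p * Real.exp (y / p) := by
    have := Real.add_one_le_exp (y / p)
    have h2 : y = p * (y / p) := by field_simp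
    nlinarith
  have h3 : y ^ p ≤ p ^ p * Real.exp y := by
    calc y ^ p ≤ (p * Real.exp (y / p)) ^ p := Real.rpow_le_rpow hy h1 hp.le
      _ = p ^ p * Real.exp y := by
        rw [Real.mul_rpow hp.le (Real.exp_pos _).le, ← Real.exp_mul]
        congr 2; field_simp
  calc y ^ p * Real.exp (-y) ≤ p ^ p * Real.exp y * Real.exp (-y) := by gcongr
    _ = p ^ p := by rw [mul_assoc, ← Real.exp_add]; simp

/-! ### Completely monotone functions -/

variable {φ m : ℝ → ℝ} {a b : ℝ}

lemma CompletelyMonotone.nonneg (h : CompletelyMonotone m) {t : ℝ} (ht : 0 < t) : 0 ≤ m t := by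
  simpa using h.2 0 t ht

/-- Nonnegativity and monotonicity, together with measurability, are all that the estimates take
from complete monotonicity. -/
lemma CompletelyMonotone.antitoneOn (h : CompletelyMonotone m) : AntitoneOn m (Ioi 0) := by
  have hd : DifferentiableOn ℝ m (Ioi 0) := h.1.differentiableOn (by simp)
  refine antitoneOn_of_deriv_nonpos (convex_Ioi 0) hd.continuousOn ?_ fun t ht => ?_
  · rw [interior_Ioi]; exact hd
  · rw [interior_Ioi] at ht
    have := h.2 1 t ht
    rw [iteratedDerivWithin_one, derivWithin_of_isOpen isOpen_Ioi ht] at this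
    linarith

lemma CompletelyMonotone.aemeasurable (h : CompletelyMonotone m) :
    AEMeasurable m (volume.restrict (Ioi 0)) :=
  h.1.continuousOn.aemeasurable measurableSet_Ioi

/-! ### Complete Bernstein functions -/

namespace IsCompleteBernstein

lemma nonneg_density (h : IsCompleteBernstein φ a b m) {t : ℝ} (ht : 0 < t) : 0 ≤ m t :=
  h.completelyMonotone.nonneg ht

lemma integrableOn (h : IsCompleteBernstein φ a b m) {l : ℝ} (hl : 0 < l) :
    IntegrableOn (fun t => (1 - Real.exp (-(l * t))) * m t) (Ioi 0) := by
  refine Integrable.mono' (h.integrable.const_mul (max 1 l)) ?_ ?_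
  · exact ((by fun_prop : Measurable fun t : ℝ => 1 - Real.exp (-(l * t))).aemeasurable.mul
      h.completelyMonotone.aemeasurable).aestronglyMeasurable
  · refine (ae_restrict_iff' measurableSet_Ioi).2 (Eventually.of_forall fun t (ht : 0 < t) => ?_)
    have h1 := one_sub_exp_neg_nonneg (mul_pos hl ht).le
    have h2 := one_sub_exp_neg_le_min (l * t)
    have h3 := h.nonneg_density ht
    rw [Real.norm_of_nonneg (mul_nonneg h1 h3), ← mul_assoc]
    gcongr
    refine h2.trans ?_
    rcases le_total t 1 with h4 | h4
    · rw [min_eq_right h4]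
      exact (min_le_right _ _).trans (mul_le_mul_of_nonneg_right (le_max_right _ _) ht.le)
    · rw [min_eq_left h4, mul_one]
      exact (min_le_left _ _).trans (le_max_left _ _)

lemma mono (h : IsCompleteBernstein φ a b m) {x y : ℝ} (hx : 0 < x) (hxy : x ≤ y) :
    φ x ≤ φ y := by
  rw [h.representation x hx, h.representation y (hx.trans_le hxy)]
  have := h.drift_nonneg
  refine add_le_add (add_le_add le_rfl (by gcongr)) ?_
  refine setIntegral_mono_on (h.integrableOn hx) (h.integrableOn (hx.trans_le hxy))
    measurableSet_Ioi fun t (ht : 0 < t) => ?_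
  have := h.nonneg_density ht
  gcongr

lemma map_mul_le (h : IsCompleteBernstein φ a b m) {c x : ℝ} (hc : 1 ≤ c) (hx : 0 < x) :
    φ (c * x) ≤ c * φ x := by
  have hcx : 0 < c * x := by positivity
  rw [h.representation x hx, h.representation _ hcx, mul_add, mul_add]
  have := h.drift_nonneg
  have h2 := h.killing_nonneg
  gcongr ?_ + ?_ + ?_
  · nlinarith
  · exact le_of_eq (by ring)
  · rw [← integral_const_mul]
    refine setIntegral_mono_on (h.integrableOn hcx) ((h.integrableOn hx).const_mul c)
      measurableSet_Ioi fun t (ht : 0 < t) => ?_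
    have := h.nonneg_density ht
    rw [← mul_assoc, mul_assoc c x t]
    gcongr
    exact one_sub_exp_neg_mul_le hc

lemma killing_le (h : IsCompleteBernstein φ a b m) {x : ℝ} (hx : 0 < x) :
    a + b * x ≤ φ x := by
  rw [h.representation x hx]
  have : 0 ≤ ∫ t in Ioi (0 : ℝ), (1 - Real.exp (-(x * t))) * m t :=
    setIntegral_nonneg measurableSet_Ioi fun t (ht : 0 < t) =>
      mul_nonneg (one_sub_exp_neg_nonneg (by positivity)) (h.nonneg_density ht)
  linarith

end IsCompleteBernstein

/-! ### Global scaling -/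

section Scaling

variable {δ₁ δ₂ δ₃ δ₄ a₁ a₂ a₃ a₄ : ℝ}

/-- A pair with `r ≤ 1 ≤ R` is chained through 1, where the two power bounds multiply. Since `R / r
≥ 1`, both exponents may be raised to their maximum. -/
lemma exists_global_upper_scaling (hφ : ∀ l, 0 < l → 0 < φ l)
    (H1 : ScalingAtInfinity φ δ₁ δ₂ a₁ a₂) (H2 : ScalingAtZero φ δ₃ δ₄ a₃ a₄) :
    ∃ C : ℝ, 0 < C ∧ ∀ r R : ℝ, 0 < r → r ≤ R → φ R ≤ C * (R / r) ^ max δ₂ δ₄ * φ r := by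
  have ha2 := H1.upper_const_pos
  have ha4 := H2.upper_const_pos
  have U1 : ∀ r R : ℝ, 1 ≤ r → r ≤ R → φ R ≤ a₂ * (R / r) ^ max δ₂ δ₄ * φ r := by
    intro r R hr hR
    have hr0 : 0 < r := by linarith
    refine ((div_le_iff₀ (hφ r hr0)).1 (H1.upper r R hr hR)).trans ?_
    have := hφ r hr0
    gcongr
    · exact (one_le_div hr0).2 hR
    · exact le_max_left _ _
  have U2 : ∀ r R : ℝ, 0 < r → r ≤ R → R ≤ 1 → φ R ≤ a₄ * (R / r) ^ max δ₂ δ₄ * φ r := by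
    intro r R hr hR hR1
    refine ((div_le_iff₀ (hφ r hr)).1 (H2.upper r R hr hR hR1)).trans ?_
    have := hφ r hr
    gcongr
    · exact (one_le_div hr).2 hR
    · exact le_max_right _ _
  refine ⟨a₂ + a₄ + a₂ * a₄, by positivity, fun r R hr hR => ?_⟩
  have hp : 0 < (R / r) ^ max δ₂ δ₄ := Real.rpow_pos_of_pos (div_pos (hr.trans_le hR) hr) _
  have hφr := hφ r hr
  rcases le_total 1 r with h1 | h1
  · refine (U1 r R h1 hR).trans ?_
    gcongr
    nlinarith [mul_pos ha2 ha4]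
  rcases le_total R 1 with h2 | h2
  · refine (U2 r R hr hR h2).trans ?_
    gcongr
    nlinarith [mul_pos ha2 ha4]
  · calc φ R ≤ a₂ * (R / 1) ^ max δ₂ δ₄ * φ 1 := U1 1 R le_rfl h2
      _ ≤ a₂ * (R / 1) ^ max δ₂ δ₄ * (a₄ * (1 / r) ^ max δ₂ δ₄ * φ r) := by
        gcongr; exact U2 r 1 hr h1 le_rfl
      _ = a₂ * a₄ * (R / r) ^ max δ₂ δ₄ * φ r := by
        have : R / r = (R / 1) * (1 / r) := by ring
        rw [this, Real.mul_rpow (by simp; linarith) (by positivity)]; ring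
      _ ≤ _ := by gcongr; linarith

/-- The lower bounds are inverted first, so that the gluing at 1 is again a product of upper bounds,
now with the smaller exponent. -/
lemma exists_global_lower_scaling (hφ : ∀ l, 0 < l → 0 < φ l)
    (H1 : ScalingAtInfinity φ δ₁ δ₂ a₁ a₂) (H2 : ScalingAtZero φ δ₃ δ₄ a₃ a₄) :
    ∃ C : ℝ, 0 < C ∧ ∀ r R : ℝ, 0 < r → r ≤ R → φ r ≤ C * (r / R) ^ min δ₁ δ₃ * φ R := by
  have ha1 := H1.lower_const_pos
  have ha3 := H2.lower_const_pos
  have key : ∀ c p r R : ℝ, 0 < c → 0 < r → r ≤ R → min δ₁ δ₃ ≤ p →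
      c * (R / r) ^ p ≤ φ R / φ r → φ r ≤ c⁻¹ * (r / R) ^ min δ₁ δ₃ * φ R := by
    intro c p r R hc hr hR hp h
    have hR0 := hr.trans_le hR
    have h1 : c * (R / r) ^ min δ₁ δ₃ * φ r ≤ φ R := by
      refine le_trans ?_ ((le_div_iff₀ (hφ r hr)).1 h)
      have := hφ r hr
      gcongr
      exact (one_le_div hr).2 hR
    have h2 : (r / R) ^ min δ₁ δ₃ = ((R / r) ^ min δ₁ δ₃)⁻¹ := by
      rw [← Real.inv_rpow (by positivity), inv_div]
    have h3 : 0 < (R / r) ^ min δ₁ δ₃ := Real.rpow_pos_of_pos (by positivity) _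
    rw [h2, ← mul_inv, inv_mul_eq_div, le_div_iff₀ (by positivity)]
    linarith
  have U1 : ∀ r R : ℝ, 1 ≤ r → r ≤ R → φ r ≤ a₁⁻¹ * (r / R) ^ min δ₁ δ₃ * φ R :=
    fun r R hr hR => key _ _ r R ha1 (by linarith) hR (min_le_left _ _) (H1.lower r R hr hR)
  have U2 : ∀ r R : ℝ, 0 < r → r ≤ R → R ≤ 1 → φ r ≤ a₃⁻¹ * (r / R) ^ min δ₁ δ₃ * φ R :=
    fun r R hr hR hR1 => key _ _ r R ha3 hr hR (min_le_right _ _) (H2.lower r R hr hR hR1)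
  have hb1 : 0 < a₁⁻¹ := by positivity
  have hb3 : 0 < a₃⁻¹ := by positivity
  refine ⟨a₁⁻¹ + a₃⁻¹ + a₁⁻¹ * a₃⁻¹, by positivity, fun r R hr hR => ?_⟩
  have hR0 := hr.trans_le hR
  have hp : 0 < (r / R) ^ min δ₁ δ₃ := Real.rpow_pos_of_pos (div_pos hr hR0) _
  have hφR := hφ R hR0
  rcases le_total 1 r with h1 | h1
  · refine (U1 r R h1 hR).trans ?_
    gcongr
    nlinarith [mul_pos hb1 hb3]
  rcases le_total R 1 with h2 | h2
  · refine (U2 r R hr hR h2).trans ?_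
    gcongr
    nlinarith [mul_pos hb1 hb3]
  · calc φ r ≤ a₃⁻¹ * (r / 1) ^ min δ₁ δ₃ * φ 1 := U2 r 1 hr h1 le_rfl
      _ ≤ a₃⁻¹ * (r / 1) ^ min δ₁ δ₃ * (a₁⁻¹ * (1 / R) ^ min δ₁ δ₃ * φ R) := by
        gcongr; exact U1 1 R le_rfl h2
      _ = a₁⁻¹ * a₃⁻¹ * (r / R) ^ min δ₁ δ₃ * φ R := by
        have : r / R = (r / 1) * (1 / R) := by ring
        rw [this, Real.mul_rpow (by simp; linarith) (by positivity)]; ring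
      _ ≤ _ := by gcongr; linarith

end Scaling

/-! ### Consequences of global scaling -/

lemma tendsto_mul_rpow_zero {ε C : ℝ} (hε : 0 < ε) :
    Tendsto (fun x : ℝ => C * x ^ ε) (𝓝[>] 0) (𝓝 0) := by
  have h : ContinuousAt (fun x : ℝ => C * x ^ ε) 0 :=
    (Real.continuousAt_rpow_const 0 ε (Or.inr hε.le)).const_mul C
  have := h.tendsto
  rw [Real.zero_rpow hε.ne', mul_zero] at this
  exact this.mono_left nhdsWithin_le_nhds

lemma exists_rpow_small {ε C η : ℝ} (hε : 0 < ε) (hη : 0 < η) :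
    ∃ x : ℝ, 0 < x ∧ x < 1 ∧ C * x ^ ε ≤ η := by
  have h1 := (tendsto_mul_rpow_zero (C := C) hε).eventually (ge_mem_nhds hη)
  have h2 : ∀ᶠ x : ℝ in 𝓝[>] 0, x ∈ Ioo (0 : ℝ) 1 := Ioo_mem_nhdsGT one_pos
  obtain ⟨x, hx, hx'⟩ := (h1.and h2).exists
  exact ⟨x, hx'.1, hx'.2, hx⟩

/-- `φ` satisfies lower and upper scaling on all of `(0, ∞)`, with exponents `δ > 0` and `δ' < 1`. -/
structure GlobalScaling (φ : ℝ → ℝ) (δ δ' C : ℝ) : Prop where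
  lower_exponent_pos : 0 < δ
  upper_exponent_lt_one : δ' < 1
  const_pos : 0 < C
  lower : ∀ r R : ℝ, 0 < r → r ≤ R → φ r ≤ C * (r / R) ^ δ * φ R
  upper : ∀ r R : ℝ, 0 < r → r ≤ R → φ R ≤ C * (R / r) ^ δ' * φ r

lemma exists_globalScaling {δ₁ δ₂ δ₃ δ₄ a₁ a₂ a₃ a₄ : ℝ} (hφ : ∀ l, 0 < l → 0 < φ l)
    (H1 : ScalingAtInfinity φ δ₁ δ₂ a₁ a₂) (H2 : ScalingAtZero φ δ₃ δ₄ a₃ a₄) :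
    ∃ δ C, GlobalScaling φ δ (max δ₂ δ₄) C := by
  obtain ⟨C₁, hC₁, hu⟩ := exists_global_upper_scaling hφ H1 H2
  obtain ⟨C₂, hC₂, hl⟩ := exists_global_lower_scaling hφ H1 H2
  refine ⟨min δ₁ δ₃, max C₁ C₂, lt_min H1.exponent_pos H2.exponent_pos,
    max_lt H1.exponent_lt_one H2.exponent_lt_one, lt_max_of_lt_left hC₁,
    fun r R hr hR => ?_, fun r R hr hR => ?_⟩
  · refine (hl r R hr hR).trans ?_
    have := hφ R (hr.trans_le hR)
    have : 0 < r / R := div_pos hr (hr.trans_le hR)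
    gcongr
    exact le_max_right _ _
  · refine (hu r R hr hR).trans ?_
    have := hφ r hr
    have : 0 < R / r := div_pos (hr.trans_le hR) hr
    gcongr
    exact le_max_left _ _

namespace IsCompleteBernstein

variable {δ δ' C : ℝ}

/-- `a ≤ φ x ≤ C x^δ φ 1`, which tends to 0 with `x`. -/
lemma killing_eq_zero (h : IsCompleteBernstein φ a b m) (hs : GlobalScaling φ δ δ' C) :
    a = 0 := by
  refine le_antisymm (le_of_forall_pos_le_add fun η hη => ?_) h.killing_nonneg
  obtain ⟨x, hx0, hx1, hx⟩ := exists_rpow_small (C := C * φ 1) hs.lower_exponent_pos hη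
  have h1 := h.killing_le hx0
  have h2 := hs.lower x 1 hx0 hx1.le
  rw [div_one] at h2
  nlinarith [mul_nonneg h.drift_nonneg hx0.le]

/-- `b ≤ φ(l) / l ≤ C l^(δ' - 1) φ 1` for `l ≥ 1`; the right side tends to 0 as `l = x⁻¹` grows,
because `δ' < 1`. -/
lemma drift_eq_zero (h : IsCompleteBernstein φ a b m) (hs : GlobalScaling φ δ δ' C) :
    b = 0 := by
  refine le_antisymm (le_of_forall_pos_le_add fun η hη => ?_) h.drift_nonneg
  obtain ⟨x, hx0, hx1, hx⟩ := exists_rpow_small (C := C * φ 1)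
    (sub_pos.2 hs.upper_exponent_lt_one) hη
  have h1 := h.killing_le (inv_pos.2 hx0)
  have h2 := hs.upper 1 x⁻¹ one_pos ((one_le_inv₀ hx0).2 hx1.le)
  rw [div_one, Real.inv_rpow hx0.le] at h2
  rw [Real.rpow_sub hx0, Real.rpow_one] at hx
  have h3 : b * x⁻¹ ≤ C * (x ^ δ')⁻¹ * φ 1 := by linarith [h.killing_nonneg]
  have h4 : b = b * x⁻¹ * x := by field_simp
  calc b = b * x⁻¹ * x := h4
    _ ≤ C * (x ^ δ')⁻¹ * φ 1 * x := by gcongr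
    _ = C * φ 1 * (x / x ^ δ') := by ring
    _ ≤ 0 + η := by linarith

lemma eq_integral (h : IsCompleteBernstein φ a b m) (hs : GlobalScaling φ δ δ' C) {l : ℝ}
    (hl : 0 < l) : φ l = ∫ t in Ioi (0 : ℝ), (1 - Real.exp (-(l * t))) * m t := by
  rw [h.representation l hl, h.killing_eq_zero hs, h.drift_eq_zero hs]
  ring

lemma ofReal_eq_lintegral (h : IsCompleteBernstein φ a b m) (hs : GlobalScaling φ δ δ' C) {l : ℝ}
    (hl : 0 < l) :
    ENNReal.ofReal (φ l) =
      ∫⁻ t in Ioi (0 : ℝ), ENNReal.ofReal ((1 - Real.exp (-(l * t))) * m t) := by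
  rw [h.eq_integral hs hl, ofReal_integral_eq_lintegral_ofReal (h.integrableOn hl)]
  refine (ae_restrict_iff' measurableSet_Ioi).2 (Eventually.of_forall fun t (ht : 0 < t) => ?_)
  exact mul_nonneg (one_sub_exp_neg_nonneg (by positivity)) (h.nonneg_density ht)

/-- The integral for `φ t⁻¹` is split at `ε t` and `t / k`. The outer ranges are bounded by
multiples of `φ` at `1/(ε t)` and at `k / t`, which scaling makes at most a quarter of `φ t⁻¹` each.
The middle range therefore carries at least half, and there `m` is at most `m (ε t)`. -/
lemma exists_density_lower_bound (h : IsCompleteBernstein φ a b m)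
    (hs : GlobalScaling φ δ δ' C) :
    ∃ c : ℝ, 0 < c ∧ ∀ t : ℝ, 0 < t → c * φ t⁻¹ ≤ t * m t := by
  have hC := hs.const_pos
  obtain ⟨ε, hε0, hε1, hε⟩ := exists_rpow_small (C := C) (η := 1 / 8)
    (sub_pos.2 hs.upper_exponent_lt_one) (by norm_num)
  obtain ⟨k, hk0, hk1, hk⟩ := exists_rpow_small (C := C) (η := 1 / 8)
    hs.lower_exponent_pos (by norm_num)
  have main : ∀ t : ℝ, 0 < t → φ t⁻¹ ≤ 2 * (k⁻¹ * t * m (ε * t)) := by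
    intro t ht
    have hM : ε * t ≤ k⁻¹ * t := by
      gcongr; exact hε1.le.trans ((one_le_inv₀ hk0).2 hk1.le)
    have hεt : 0 < (ε * t)⁻¹ := by positivity
    have hkt : 0 < k * t⁻¹ := by positivity
    have hind : IntegrableOn ((Ioc (ε * t) (k⁻¹ * t)).indicator fun _ => m (ε * t)) (Ioi 0) := by
      refine ((integrable_indicator_iff measurableSet_Ioc).2 ?_).integrableOn
      exact integrableOn_const (by simp)
    have h1 : φ t⁻¹ ≤ 2 * ε * φ (ε * t)⁻¹ + 2 * φ (k * t⁻¹) +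
        (k⁻¹ * t - ε * t) * m (ε * t) := by
      rw [h.eq_integral hs (inv_pos.2 ht), h.eq_integral hs hεt, h.eq_integral hs hkt]
      have h3 : (k⁻¹ * t - ε * t) * m (ε * t) =
          ∫ s in Ioi (0 : ℝ), (Ioc (ε * t) (k⁻¹ * t)).indicator (fun _ => m (ε * t)) s := by
        rw [integral_indicator measurableSet_Ioc, Measure.restrict_restrict measurableSet_Ioc,
          inter_eq_self_of_subset_left, setIntegral_const]
        · simp [Measure.real, hM]
        · exact fun s hs => (by positivity : 0 < ε * t).trans hs.1
      have hsum : IntegrableOn (fun s => 2 * ε * ((1 - Real.exp (-((ε * t)⁻¹ * s))) * m s) +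
          2 * ((1 - Real.exp (-(k * t⁻¹ * s))) * m s)) (Ioi 0) :=
        ((h.integrableOn hεt).const_mul _).add ((h.integrableOn hkt).const_mul _)
      rw [h3, ← integral_const_mul, ← integral_const_mul,
        ← integral_add ((h.integrableOn hεt).const_mul _) ((h.integrableOn hkt).const_mul _),
        ← integral_add hsum hind]
      refine setIntegral_mono_on (h.integrableOn (inv_pos.2 ht))
        (hsum.add hind)
        measurableSet_Ioi fun s (hs0 : 0 < s) => ?_
      have hm := h.nonneg_density hs0
      have e1 := one_sub_exp_neg_nonneg (mul_pos hεt hs0).le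
      have e2 := one_sub_exp_neg_nonneg (mul_pos hkt hs0).le
      have hind0 : 0 ≤ (Ioc (ε * t) (k⁻¹ * t)).indicator (fun _ => m (ε * t)) s :=
        indicator_nonneg (fun _ _ => h.nonneg_density (by positivity)) s
      have e0 := one_sub_exp_neg_le_min (t⁻¹ * s)
      have f1 := min_one_le_two_mul_one_sub_exp_neg (mul_pos hεt hs0).le
      have f2 := min_one_le_two_mul_one_sub_exp_neg (mul_pos hkt hs0).le
      -- For small `s` the kernel is at most `s / t = ε · s/(ε t)`, which gains the factor `ε`; in
      -- the middle it is at most 1 and `m` decreases; for large `s` the kernel at `k / t` is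
      -- already bounded below.
      rcases le_or_gt s (ε * t) with c1 | c1
      · have g1 : (ε * t)⁻¹ * s ≤ 1 := by rw [inv_mul_le_iff₀ (by positivity)]; linarith
        rw [min_eq_right g1] at f1
        have g2 : t⁻¹ * s = ε * ((ε * t)⁻¹ * s) := by field_simp
        have g3 : 1 - Real.exp (-(t⁻¹ * s)) ≤ 2 * ε * (1 - Real.exp (-((ε * t)⁻¹ * s))) := by
          have := e0.trans (min_le_right _ _)
          nlinarith
        nlinarith [mul_le_mul_of_nonneg_right g3 hm, mul_nonneg e2 hm]
      rcases le_or_gt s (k⁻¹ * t) with c2 | c2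
      · have hmem : s ∈ Ioc (ε * t) (k⁻¹ * t) := ⟨c1, c2⟩
        rw [indicator_of_mem hmem]
        have g1 : m s ≤ m (ε * t) :=
          h.completelyMonotone.antitoneOn (by simp; positivity) hs0 c1.le
        have g2 : 1 - Real.exp (-(t⁻¹ * s)) ≤ 1 := e0.trans (min_le_left _ _)
        nlinarith [mul_le_mul_of_nonneg_right g2 hm, mul_nonneg e2 hm,
          mul_nonneg hε0.le (mul_nonneg e1 hm)]
      · have g1 : 1 ≤ k * t⁻¹ * s := by
          rw [inv_mul_lt_iff₀ hk0] at c2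
          rw [mul_right_comm, ← div_eq_mul_inv, one_le_div ht]; exact c2.le
        rw [min_eq_left g1] at f2
        have g2 : 1 - Real.exp (-(t⁻¹ * s)) ≤ 2 * (1 - Real.exp (-(k * t⁻¹ * s))) :=
          (e0.trans (min_le_left _ _)).trans f2
        nlinarith [mul_le_mul_of_nonneg_right g2 hm, mul_nonneg hε0.le (mul_nonneg e1 hm)]
    have hφt := h.pos t⁻¹ (inv_pos.2 ht)
    have h2 : 2 * ε * φ (ε * t)⁻¹ ≤ φ t⁻¹ / 4 := by
      have := hs.upper t⁻¹ (ε * t)⁻¹ (inv_pos.2 ht)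
        (inv_anti₀ (by positivity) (by nlinarith))
      have e : (ε * t)⁻¹ / t⁻¹ = ε⁻¹ := by field_simp
      rw [e, Real.inv_rpow hε0.le] at this
      rw [Real.rpow_sub hε0, Real.rpow_one] at hε
      calc 2 * ε * φ (ε * t)⁻¹ ≤ 2 * ε * (C * (ε ^ δ')⁻¹ * φ t⁻¹) := by gcongr
        _ = 2 * (C * (ε / ε ^ δ')) * φ t⁻¹ := by ring
        _ ≤ 2 * (1 / 8) * φ t⁻¹ := by gcongr
        _ = φ t⁻¹ / 4 := by ring
    have h3 : 2 * φ (k * t⁻¹) ≤ φ t⁻¹ / 4 := by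
      have := hs.lower (k * t⁻¹) t⁻¹ hkt (by have := inv_pos.2 ht; nlinarith)
      have e : k * t⁻¹ / t⁻¹ = k := by field_simp
      rw [e] at this
      nlinarith
    have h4 : (k⁻¹ * t - ε * t) * m (ε * t) ≤ k⁻¹ * t * m (ε * t) := by
      have := h.nonneg_density (t := ε * t) (by positivity)
      gcongr
      nlinarith
    linarith
  -- `main` is applied at `t / ε` to land on `m t`; one factor `ε` comes from this rescaling and the
  -- other from comparing `φ (ε / t)` with `φ t⁻¹`.
  refine ⟨k * ε ^ 2 / 2, by positivity, fun t ht => ?_⟩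
  have h1 := main (t / ε) (by positivity)
  have h2 : ε * (t / ε) = t := by field_simp
  rw [h2, inv_div] at h1
  have h3 : φ t⁻¹ ≤ ε⁻¹ * φ (ε / t) := by
    have := h.map_mul_le (c := ε⁻¹) (x := ε / t) ((one_le_inv₀ hε0).2 hε1.le) (by positivity)
    have e : ε⁻¹ * (ε / t) = t⁻¹ := by field_simp
    rwa [e] at this
  calc k * ε ^ 2 / 2 * φ t⁻¹ ≤ k * ε ^ 2 / 2 * (ε⁻¹ * (2 * (k⁻¹ * (t / ε) * m t))) := by
        gcongr; exact h3.trans (by gcongr)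
    _ = t * m t := by field_simp

end IsCompleteBernstein

/-! ### The heat kernel -/

section HeatKernel

variable {d : ℕ}

lemma heatKernel_nonneg {t : ℝ} (ht : 0 ≤ t) (x : EuclideanSpace ℝ (Fin d)) :
    0 ≤ heatKernel d t x := by
  have := Real.pi_pos
  unfold heatKernel; positivity

lemma measurable_heatKernel :
    Measurable fun p : ℝ × EuclideanSpace ℝ (Fin d) => heatKernel d p.1 p.2 := by
  unfold heatKernel; fun_prop

lemma heatKernel_neg (t : ℝ) (x : EuclideanSpace ℝ (Fin d)) :
    heatKernel d t (-x) = heatKernel d t x := by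
  simp [heatKernel]

lemma sq_rpow_half_nat {r : ℝ} (hr : 0 ≤ r) (d : ℕ) : (r ^ 2) ^ ((d : ℝ) / 2) = r ^ d := by
  rw [← Real.rpow_natCast r 2, ← Real.rpow_mul hr, ← Real.rpow_natCast r d]
  congr 1; push_cast; ring

lemma heatKernel_le_rpow {t : ℝ} (ht : 0 < t) (x : EuclideanSpace ℝ (Fin d)) :
    heatKernel d t x ≤ (t⁻¹) ^ ((d : ℝ) / 2) := by
  have hpi := Real.pi_gt_three
  unfold heatKernel
  rw [Real.rpow_neg (by positivity), ← Real.inv_rpow (by positivity)]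
  have h1 : Real.exp (-(‖x‖ ^ 2 / (4 * t))) ≤ 1 :=
    Real.exp_le_one_iff.2 (neg_nonpos.2 (by positivity))
  calc ((4 * Real.pi * t)⁻¹) ^ ((d : ℝ) / 2) * Real.exp (-(‖x‖ ^ 2 / (4 * t)))
      ≤ (t⁻¹) ^ ((d : ℝ) / 2) * 1 := by gcongr; nlinarith
    _ = _ := mul_one _

/-- The parabolic variable `z = |x|²/(4t)` isolates `|x|^(-d)`; what remains is a function of `z`
alone. -/
lemma heatKernel_eq {t : ℝ} (ht : 0 < t) {x : EuclideanSpace ℝ (Fin d)} (hx : x ≠ 0) :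
    heatKernel d t x = (Real.pi⁻¹) ^ ((d : ℝ) / 2) * (‖x‖ ^ d)⁻¹ *
      ((‖x‖ ^ 2 / (4 * t)) ^ ((d : ℝ) / 2) * Real.exp (-(‖x‖ ^ 2 / (4 * t)))) := by
  have hpi := Real.pi_pos
  have hr : 0 < ‖x‖ := norm_pos_iff.2 hx
  unfold heatKernel
  rw [← mul_assoc, Real.rpow_neg (by positivity), ← Real.inv_rpow (by positivity),
    ← sq_rpow_half_nat hr.le d, ← Real.inv_rpow (by positivity),
    ← Real.mul_rpow (by positivity) (by positivity),
    ← Real.mul_rpow (by positivity) (by positivity)]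
  congr 2
  field_simp

/-- Both `z^(d/2) exp(-z)` and `z` times it are bounded; the second bound gives decay in `t/|x|²`
for small times. -/
lemma exists_heatKernel_le (hd : 1 ≤ d) : ∃ K : ℝ, 0 < K ∧
    ∀ (t : ℝ) (x : EuclideanSpace ℝ (Fin d)), 0 < t → x ≠ 0 →
      heatKernel d t x ≤ K * (‖x‖ ^ d)⁻¹ * min 1 ((‖x‖ ^ 2)⁻¹ * t) := by
  have hpi := Real.pi_pos
  have hd0 : (0 : ℝ) < d := by exact_mod_cast hd
  refine ⟨(Real.pi⁻¹) ^ ((d : ℝ) / 2) * (((d : ℝ) / 2) ^ ((d : ℝ) / 2) +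
    4 * ((d : ℝ) / 2 + 1) ^ ((d : ℝ) / 2 + 1)), by positivity, fun t x ht hx => ?_⟩
  have hr : 0 < ‖x‖ := norm_pos_iff.2 hx
  rw [heatKernel_eq ht hx]
  set z := ‖x‖ ^ 2 / (4 * t) with hz
  have hz0 : 0 < z := by positivity
  have h1 := rpow_mul_exp_neg_le (p := (d : ℝ) / 2) (by positivity) hz0.le
  have h2 := rpow_mul_exp_neg_le (p := (d : ℝ) / 2 + 1) (by positivity) hz0.le
  rw [Real.rpow_add hz0, Real.rpow_one] at h2
  have e : (‖x‖ ^ 2)⁻¹ * t = (4 * z)⁻¹ := by rw [hz]; field_simp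
  rw [e]
  set A := ((d : ℝ) / 2) ^ ((d : ℝ) / 2)
  set B := ((d : ℝ) / 2 + 1) ^ ((d : ℝ) / 2 + 1)
  have hA : 0 < A := by positivity
  have hB : 0 < B := by positivity
  have key : z ^ ((d : ℝ) / 2) * Real.exp (-z) ≤ (A + 4 * B) * min 1 (4 * z)⁻¹ := by
    rcases le_total 1 (4 * z)⁻¹ with h | h
    · rw [min_eq_left h]; linarith
    · rw [min_eq_right h, ← div_eq_mul_inv, le_div_iff₀ (by positivity)]
      nlinarith
  calc _ ≤ (Real.pi⁻¹) ^ ((d : ℝ) / 2) * (‖x‖ ^ d)⁻¹ * ((A + 4 * B) * min 1 (4 * z)⁻¹) := by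
        gcongr
    _ = _ := by ring

lemma heatKernel_ge {ε M : ℝ} (hε : 0 < ε) {t : ℝ} {x : EuclideanSpace ℝ (Fin d)} (hx : x ≠ 0)
    (h1 : ε * ‖x‖ ^ 2 ≤ t) (h2 : t ≤ M * ‖x‖ ^ 2) :
    (4 * Real.pi * M) ^ (-((d : ℝ) / 2)) * Real.exp (-(4 * ε)⁻¹) * (‖x‖ ^ d)⁻¹ ≤
      heatKernel d t x := by
  have hpi := Real.pi_pos
  have hr : 0 < ‖x‖ := norm_pos_iff.2 hx
  have hr2 : 0 < ‖x‖ ^ 2 := by positivity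
  have ht : 0 < t := (by positivity : 0 < ε * ‖x‖ ^ 2).trans_le h1
  have hM : 0 < M := pos_of_mul_pos_left (ht.trans_le h2) hr2.le
  have e1 : (4 * Real.pi * M) ^ (-((d : ℝ) / 2)) * (‖x‖ ^ d)⁻¹ ≤
      (4 * Real.pi * t) ^ (-((d : ℝ) / 2)) := by
    rw [Real.rpow_neg (by positivity), Real.rpow_neg (by positivity),
      ← sq_rpow_half_nat hr.le d, ← mul_inv, ← Real.mul_rpow (by positivity) (by positivity)]
    refine inv_anti₀ (by positivity) (Real.rpow_le_rpow (by positivity) ?_ (by positivity))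
    rw [mul_assoc _ M]
    gcongr
  have e2 : ‖x‖ ^ 2 / (4 * t) ≤ (4 * ε)⁻¹ := by
    rw [div_le_iff₀ (by positivity)]
    field_simp
    linarith
  unfold heatKernel
  calc _ = (4 * Real.pi * M) ^ (-((d : ℝ) / 2)) * (‖x‖ ^ d)⁻¹ * Real.exp (-(4 * ε)⁻¹) := by ring
    _ ≤ _ := by gcongr

/-! ### Gaussian integrals -/

lemma integrable_heatKernel {s : ℝ} (hs : 0 < s) : Integrable (heatKernel d s) := by
  have h := (GaussianFourier.integrable_cexp_neg_mul_sq_norm_add (b := ((4 * s)⁻¹ : ℝ))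
    (by simpa using hs) 0 (0 : EuclideanSpace ℝ (Fin d))).norm
  refine (h.const_mul ((4 * Real.pi * s) ^ (-((d : ℝ) / 2)))).congr
    (Eventually.of_forall fun x => ?_)
  simp only [heatKernel, Complex.norm_exp]
  congr 2
  simp [← Complex.ofReal_pow, ← Complex.ofReal_mul]
  field_simp

lemma integral_cexp_mul_heatKernel {s : ℝ} (hs : 0 < s) (ξ : EuclideanSpace ℝ (Fin d)) :
    ∫ x : EuclideanSpace ℝ (Fin d), Complex.exp (⟪x, ξ⟫ * Complex.I) * (heatKernel d s x : ℂ) =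
      Complex.exp (-((s : ℂ) * (‖ξ‖ : ℂ) ^ 2)) := by
  have hpi := Real.pi_pos
  have h := GaussianFourier.integral_cexp_neg_mul_sq_norm_add (b := ((4 * s)⁻¹ : ℝ))
    (by simpa using hs) Complex.I ξ
  have e : ∀ x : EuclideanSpace ℝ (Fin d),
      Complex.exp (⟪x, ξ⟫ * Complex.I) * (heatKernel d s x : ℂ) =
      ((4 * Real.pi * s) ^ (-((d : ℝ) / 2)) : ℝ) *
        Complex.exp (-((4 * s)⁻¹ : ℝ) * ‖x‖ ^ 2 + Complex.I * ⟪ξ, x⟫) := by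
    intro x
    rw [heatKernel, Complex.ofReal_mul, Complex.ofReal_exp, mul_left_comm, ← Complex.exp_add,
      real_inner_comm]
    congr 2
    push_cast
    have : (s : ℂ) ≠ 0 := by exact_mod_cast hs.ne'
    field_simp
    ring
  simp_rw [e]
  rw [integral_const_mul, h]
  have e2 : ((Real.pi : ℂ) / ((4 * s)⁻¹ : ℝ)) ^ ((Module.finrank ℝ (EuclideanSpace ℝ (Fin d)) : ℂ) / 2)
      = ((4 * Real.pi * s) ^ ((d : ℝ) / 2) : ℝ) := by
    rw [Complex.ofReal_cpow (by positivity), finrank_euclideanSpace_fin]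
    push_cast
    congr 1
    have : (s : ℂ) ≠ 0 := by exact_mod_cast hs.ne'
    field_simp
  rw [e2, ← mul_assoc, ← Complex.ofReal_mul, ← Real.rpow_add (by positivity), neg_add_cancel,
    Real.rpow_zero, Complex.ofReal_one, one_mul]
  congr 1
  push_cast
  have : (s : ℂ) ≠ 0 := by exact_mod_cast hs.ne'
  rw [Complex.I_sq]
  field_simp

lemma integral_cos_mul_heatKernel {s : ℝ} (hs : 0 < s) (ξ : EuclideanSpace ℝ (Fin d)) :
    ∫ x : EuclideanSpace ℝ (Fin d), Real.cos ⟪x, ξ⟫ * heatKernel d s x =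
      Real.exp (-(s * ‖ξ‖ ^ 2)) := by
  have h := congrArg Complex.re (integral_cexp_mul_heatKernel hs ξ)
  have hi : Integrable fun x : EuclideanSpace ℝ (Fin d) =>
      Complex.exp (⟪x, ξ⟫ * Complex.I) * (heatKernel d s x : ℂ) := by
    refine (integrable_heatKernel hs).mono' ?_ (Eventually.of_forall fun x => ?_)
    · exact ((by fun_prop : Continuous fun x : EuclideanSpace ℝ (Fin d) =>
        Complex.exp (⟪x, ξ⟫ * Complex.I)).aestronglyMeasurable).mul
        (integrable_heatKernel hs).ofReal.aestronglyMeasurable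
    · rw [norm_mul, Complex.norm_exp_ofReal_mul_I, one_mul, Complex.norm_real,
        Real.norm_of_nonneg (heatKernel_nonneg hs.le x)]
  have h2 := integral_re hi
  simp only [RCLike.re_to_complex] at h2
  rw [← h2] at h
  simp only [Complex.re_mul_ofReal, Complex.exp_ofReal_mul_I_re] at h
  rw [h]
  have : -((s : ℂ) * (‖ξ‖ : ℂ) ^ 2) = ((-(s * ‖ξ‖ ^ 2) : ℝ) : ℂ) := by push_cast; rfl
  rw [this, Complex.exp_ofReal_re]

lemma integral_heatKernel {s : ℝ} (hs : 0 < s) :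
    ∫ x : EuclideanSpace ℝ (Fin d), heatKernel d s x = 1 := by
  simpa using integral_cos_mul_heatKernel hs (0 : EuclideanSpace ℝ (Fin d))

lemma lintegral_heatKernel {s : ℝ} (hs : 0 < s) :
    ∫⁻ x : EuclideanSpace ℝ (Fin d), ENNReal.ofReal (heatKernel d s x) = 1 := by
  rw [← ofReal_integral_eq_lintegral_ofReal (integrable_heatKernel hs)
    (Eventually.of_forall fun x => heatKernel_nonneg hs.le x), integral_heatKernel hs,
    ENNReal.ofReal_one]

lemma integral_exp_mul_heatKernel {s : ℝ} (hs : 0 < s) :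
    ∫ x : EuclideanSpace ℝ (Fin d), Real.exp (-‖x‖ ^ 2) * heatKernel d s x =
      (1 + 4 * s) ^ (-((d : ℝ) / 2)) := by
  have hpi := Real.pi_pos
  have e : ∀ x : EuclideanSpace ℝ (Fin d), Real.exp (-‖x‖ ^ 2) * heatKernel d s x =
      (4 * Real.pi * s) ^ (-((d : ℝ) / 2)) * Real.exp (-(1 + (4 * s)⁻¹) * ‖x‖ ^ 2) := by
    intro x
    rw [heatKernel, mul_left_comm, ← Real.exp_add]
    congr 2
    field_simp
    ring
  simp_rw [e]
  rw [integral_const_mul, GaussianFourier.integral_rexp_neg_mul_sq_norm (by positivity),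
    finrank_euclideanSpace_fin, Real.rpow_neg (by positivity), Real.rpow_neg (by positivity),
    ← Real.inv_rpow (by positivity), ← Real.inv_rpow (by positivity),
    ← Real.mul_rpow (by positivity) (by positivity)]
  congr 1
  field_simp
  ring

lemma lintegral_one_sub_cos_mul_heatKernel {s : ℝ} (hs : 0 < s) (ξ : EuclideanSpace ℝ (Fin d)) :
    ∫⁻ x : EuclideanSpace ℝ (Fin d), ENNReal.ofReal ((1 - Real.cos ⟪x, ξ⟫) * heatKernel d s x) =
      ENNReal.ofReal (1 - Real.exp (-(‖ξ‖ ^ 2 * s))) := by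
  have hq := integrable_heatKernel (d := d) hs
  have hc : Integrable fun x : EuclideanSpace ℝ (Fin d) =>
      Real.cos ⟪x, ξ⟫ * heatKernel d s x := by
    refine hq.bdd_mul (c := 1) (by fun_prop : Continuous fun x : EuclideanSpace ℝ (Fin d) =>
      Real.cos ⟪x, ξ⟫).aestronglyMeasurable (Eventually.of_forall fun x => ?_)
    exact Real.abs_cos_le_one _
  have hi : Integrable fun x : EuclideanSpace ℝ (Fin d) =>
      (1 - Real.cos ⟪x, ξ⟫) * heatKernel d s x := by
    simp only [sub_mul, one_mul]
    exact hq.sub hc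
  rw [← ofReal_integral_eq_lintegral_ofReal hi (Eventually.of_forall fun x =>
    mul_nonneg (by linarith [Real.cos_le_one ⟪x, ξ⟫]) (heatKernel_nonneg hs.le x))]
  simp_rw [sub_mul, one_mul]
  rw [integral_sub hq hc, integral_heatKernel hs, integral_cos_mul_heatKernel hs, mul_comm s]

/-- The exact value is `1 - (1 + 4s)^(-d/2)`. Bounding `1 + 4s` by `exp (4s)` turns it into the
kernel of `φ (2d)`, so that integration against `m` is finite; this is what makes `J` a Lévy
density. -/
lemma lintegral_one_sub_exp_mul_heatKernel_le {s : ℝ} (hs : 0 < s) :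
    ∫⁻ x : EuclideanSpace ℝ (Fin d),
        ENNReal.ofReal ((1 - Real.exp (-‖x‖ ^ 2)) * heatKernel d s x) ≤
      ENNReal.ofReal (1 - Real.exp (-(2 * d * s))) := by
  have hq := integrable_heatKernel (d := d) hs
  have hc : Integrable fun x : EuclideanSpace ℝ (Fin d) =>
      Real.exp (-‖x‖ ^ 2) * heatKernel d s x := by
    refine hq.bdd_mul (c := 1) (by fun_prop : Continuous fun x : EuclideanSpace ℝ (Fin d) =>
      Real.exp (-‖x‖ ^ 2)).aestronglyMeasurable (Eventually.of_forall fun x => ?_)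
    rw [Real.norm_of_nonneg (Real.exp_pos _).le]
    exact Real.exp_le_one_iff.2 (by simp)
  have hi : Integrable fun x : EuclideanSpace ℝ (Fin d) =>
      (1 - Real.exp (-‖x‖ ^ 2)) * heatKernel d s x := by
    simp only [sub_mul, one_mul]
    exact hq.sub hc
  rw [← ofReal_integral_eq_lintegral_ofReal hi (Eventually.of_forall fun x =>
    mul_nonneg (one_sub_exp_neg_nonneg (by positivity)) (heatKernel_nonneg hs.le x))]
  simp_rw [sub_mul, one_mul]
  rw [integral_sub hq hc, integral_heatKernel hs, integral_exp_mul_heatKernel hs]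
  gcongr
  rw [Real.rpow_neg (by positivity), Real.exp_neg]
  gcongr
  calc (1 + 4 * s) ^ ((d : ℝ) / 2) ≤ (Real.exp (4 * s)) ^ ((d : ℝ) / 2) := by
        gcongr; linarith [Real.add_one_le_exp (4 * s)]
    _ = Real.exp (2 * d * s) := by rw [← Real.exp_mul]; ring_nf

end HeatKernel

/-! ### Two-sided bounds for the jump density -/

theorem comparable_jumpDensity {d : ℕ} (hd : 1 ≤ d) {φ m : ℝ → ℝ} {a b δ δ' C : ℝ}
    (hφ : IsCompleteBernstein φ a b m) (hs : GlobalScaling φ δ δ' C) :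
    ComparableOffZero (jumpDensity d m) (fun x => (‖x‖ ^ d)⁻¹ * φ ((‖x‖ ^ 2)⁻¹)) := by
  have hpi := Real.pi_pos
  obtain ⟨K, hK, hup⟩ := exists_heatKernel_le hd
  obtain ⟨c₀, hc₀, hlow⟩ := hφ.exists_density_lower_bound hs
  set k := (4 * Real.pi * 2) ^ (-((d : ℝ) / 2)) * Real.exp (-(4 * 1)⁻¹) with hk
  have hk0 : 0 < k := by positivity
  have upper : ∀ x : EuclideanSpace ℝ (Fin d), x ≠ 0 → jumpDensity d m x ≤
      ENNReal.ofReal (2 * K * ((‖x‖ ^ d)⁻¹ * φ ((‖x‖ ^ 2)⁻¹))) := by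
    intro x hx
    have hr : 0 < ‖x‖ := norm_pos_iff.2 hx
    rw [← mul_assoc, ENNReal.ofReal_mul (by positivity),
      hφ.ofReal_eq_lintegral hs (by positivity), ← lintegral_const_mul' _ _ ENNReal.ofReal_ne_top,
      jumpDensity]
    refine setLIntegral_mono' measurableSet_Ioi fun t (ht : 0 < t) => ?_
    rw [← ENNReal.ofReal_mul (by positivity), ← mul_assoc]
    have hm := hφ.nonneg_density ht
    refine ENNReal.ofReal_le_ofReal (mul_le_mul_of_nonneg_right ?_ hm)
    calc heatKernel d t x ≤ K * (‖x‖ ^ d)⁻¹ * min 1 ((‖x‖ ^ 2)⁻¹ * t) := hup t x ht hx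
      _ ≤ K * (‖x‖ ^ d)⁻¹ * (2 * (1 - Real.exp (-((‖x‖ ^ 2)⁻¹ * t)))) := by
        gcongr; exact min_one_le_two_mul_one_sub_exp_neg (by positivity)
      _ = _ := by ring
  have lower : ∀ x : EuclideanSpace ℝ (Fin d), x ≠ 0 →
      ENNReal.ofReal (k * c₀ / 4 * ((‖x‖ ^ d)⁻¹ * φ ((‖x‖ ^ 2)⁻¹))) ≤ jumpDensity d m x := by
    intro x hx
    have hr : 0 < ‖x‖ := norm_pos_iff.2 hx
    set R := ‖x‖ ^ 2 with hR
    have hR0 : 0 < R := by positivity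
    have hφR := hφ.pos R⁻¹ (by positivity)
    -- On this window of length `R` the kernel is of order `|x|^(-d)`, and `m t ≥ m (2R)` is at
    -- least `c₀ φ(1/(2R)) / (2R)`, hence at least `c₀ φ(1/R) / (4R)`.
    have hb : ∀ t ∈ Icc R (2 * R),
        ENNReal.ofReal (k * c₀ / 4 * ((‖x‖ ^ d)⁻¹ * φ R⁻¹) / R) ≤
          ENNReal.ofReal (heatKernel d t x * m t) := by
      intro t ht
      have ht0 : 0 < t := hR0.trans_le ht.1
      have h1 : k * (‖x‖ ^ d)⁻¹ ≤ heatKernel d t x :=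
        heatKernel_ge one_pos hx (by simpa using ht.1) ht.2
      have h2 : m (2 * R) ≤ m t :=
        hφ.completelyMonotone.antitoneOn ht0 (by simp [hR0]) ht.2
      have h3 := hlow (2 * R) (by positivity)
      have h4 : φ R⁻¹ ≤ 2 * φ (2 * R)⁻¹ := by
        have := hφ.map_mul_le (c := 2) (x := (2 * R)⁻¹) (by norm_num) (by positivity)
        have e : 2 * (2 * R)⁻¹ = R⁻¹ := by field_simp
        rwa [e] at this
      refine ENNReal.ofReal_le_ofReal ?_
      have h5 : c₀ / 4 * φ R⁻¹ / R ≤ m t := by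
        rw [div_le_iff₀ hR0]
        nlinarith
      calc k * c₀ / 4 * ((‖x‖ ^ d)⁻¹ * φ R⁻¹) / R
          = (k * (‖x‖ ^ d)⁻¹) * (c₀ / 4 * φ R⁻¹ / R) := by ring
        _ ≤ _ := mul_le_mul h1 h5 (by positivity) (heatKernel_nonneg ht0.le x)
    calc ENNReal.ofReal (k * c₀ / 4 * ((‖x‖ ^ d)⁻¹ * φ R⁻¹))
        = ENNReal.ofReal (k * c₀ / 4 * ((‖x‖ ^ d)⁻¹ * φ R⁻¹) / R) * volume (Icc R (2 * R)) := by
          rw [Real.volume_Icc, ← ENNReal.ofReal_mul (by positivity)]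
          congr 1; field_simp; ring
      _ = ∫⁻ _ in Icc R (2 * R),
            ENNReal.ofReal (k * c₀ / 4 * ((‖x‖ ^ d)⁻¹ * φ R⁻¹) / R) := by
          rw [setLIntegral_const]
      _ ≤ ∫⁻ t in Icc R (2 * R), ENNReal.ofReal (heatKernel d t x * m t) :=
          setLIntegral_mono' measurableSet_Icc hb
      _ ≤ _ := lintegral_mono_set fun t ht => hR0.trans_le ht.1
  refine ⟨max 1 (max (2 * K) (k * c₀ / 4)⁻¹), le_max_left _ _, fun x hx => ⟨?_, ?_⟩⟩
  · have hr : 0 < ‖x‖ := norm_pos_iff.2 hx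
    have := hφ.pos (‖x‖ ^ 2)⁻¹ (by positivity)
    refine le_trans (ENNReal.ofReal_le_ofReal ?_) (lower x hx)
    gcongr
    refine inv_le_of_inv_le₀ (by positivity) ?_
    exact (le_max_right _ _).trans (le_max_right _ _)
  · have hr : 0 < ‖x‖ := norm_pos_iff.2 hx
    have := hφ.pos (‖x‖ ^ 2)⁻¹ (by positivity)
    refine (upper x hx).trans (ENNReal.ofReal_le_ofReal ?_)
    gcongr
    exact (le_max_left _ _).trans (le_max_right _ _)

/-! ### The Lévy measure -/

section LevyMeasure

variable {d : ℕ} {φ m : ℝ → ℝ} {a b δ δ' C : ℝ}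

/-- The measure on `(0, ∞)` with density `m`. -/
noncomputable def densityMeasure (m : ℝ → ℝ) : Measure ℝ :=
  (volume.restrict (Ioi 0)).withDensity fun t => ENNReal.ofReal (m t)

instance (m : ℝ → ℝ) : SFinite (densityMeasure m) := by
  unfold densityMeasure; infer_instance

lemma lintegral_densityMeasure (hm : CompletelyMonotone m) {f : ℝ → ℝ≥0∞} (hf : Measurable f) :
    ∫⁻ t, f t ∂densityMeasure m = ∫⁻ t in Ioi (0 : ℝ), f t * ENNReal.ofReal (m t) := by
  rw [densityMeasure, lintegral_withDensity_eq_lintegral_mul₀ hm.aemeasurable.ennreal_ofReal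
    hf.aemeasurable]
  simp only [Pi.mul_apply, mul_comm]

lemma ae_densityMeasure_pos (m : ℝ → ℝ) : ∀ᵐ t ∂densityMeasure m, 0 < t :=
  (withDensity_absolutelyContinuous _ _).ae_le (ae_restrict_mem measurableSet_Ioi)

lemma IsCompleteBernstein.lintegral_densityMeasure (hφ : IsCompleteBernstein φ a b m)
    (hs : GlobalScaling φ δ δ' C) {l : ℝ} (hl : 0 < l) :
    ∫⁻ t, ENNReal.ofReal (1 - Real.exp (-(l * t))) ∂densityMeasure m = ENNReal.ofReal (φ l) := by
  rw [SubBM.lintegral_densityMeasure hφ.completelyMonotone (by fun_prop),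
    hφ.ofReal_eq_lintegral hs hl]
  refine setLIntegral_congr_fun measurableSet_Ioi fun t (ht : 0 < t) => ?_
  exact (ENNReal.ofReal_mul (one_sub_exp_neg_nonneg (by positivity))).symm

lemma jumpDensity_eq (hm : CompletelyMonotone m) (x : EuclideanSpace ℝ (Fin d)) :
    jumpDensity d m x = ∫⁻ t, ENNReal.ofReal (heatKernel d t x) ∂densityMeasure m := by
  have hq : Measurable fun t => ENNReal.ofReal (heatKernel d t x) :=
    (measurable_heatKernel.comp (measurable_id.prodMk measurable_const)).ennreal_ofReal
  rw [lintegral_densityMeasure hm hq]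
  exact setLIntegral_congr_fun measurableSet_Ioi fun t (ht : 0 < t) =>
    ENNReal.ofReal_mul (heatKernel_nonneg ht.le x)

lemma measurable_jumpDensity (hm : CompletelyMonotone m) : Measurable (jumpDensity d m) := by
  have h : jumpDensity d m = fun x : EuclideanSpace ℝ (Fin d) =>
      ∫⁻ t, ENNReal.ofReal (heatKernel d t x) ∂densityMeasure m := funext (jumpDensity_eq hm)
  rw [h]
  exact Measurable.lintegral_prod_right'
    (f := fun p : EuclideanSpace ℝ (Fin d) × ℝ => ENNReal.ofReal (heatKernel d p.2 p.1))
    (measurable_heatKernel.comp measurable_swap).ennreal_ofReal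

/-- Tonelli: integrals against `J` become Gaussian expectations averaged over `m`. -/
lemma lintegral_withDensity_jumpDensity (hm : CompletelyMonotone m)
    {f : EuclideanSpace ℝ (Fin d) → ℝ} (hf : Measurable f) (hf0 : ∀ x, 0 ≤ f x) :
    ∫⁻ x, ENNReal.ofReal (f x) ∂(volume.withDensity (jumpDensity d m)) =
      ∫⁻ t, (∫⁻ x, ENNReal.ofReal (f x * heatKernel d t x)) ∂densityMeasure m := by
  rw [lintegral_withDensity_eq_lintegral_mul _ (measurable_jumpDensity hm) hf.ennreal_ofReal]
  simp only [Pi.mul_apply, jumpDensity_eq hm]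
  simp_rw [ENNReal.ofReal_mul (hf0 _), mul_comm _ (ENNReal.ofReal (f _))]
  rw [lintegral_lintegral_swap]
  · refine lintegral_congr fun x => (lintegral_const_mul' _ _ ENNReal.ofReal_ne_top).symm
  · exact ((hf.comp measurable_snd).ennreal_ofReal.mul
      measurable_heatKernel.ennreal_ofReal).aemeasurable

lemma measurePreserving_neg_jumpDensity (hm : CompletelyMonotone m) :
    MeasurePreserving (Neg.neg : EuclideanSpace ℝ (Fin d) → EuclideanSpace ℝ (Fin d))
      (volume.withDensity (jumpDensity d m)) (volume.withDensity (jumpDensity d m)) := by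
  refine ⟨measurable_neg, Measure.ext fun A hA => ?_⟩
  rw [Measure.map_apply measurable_neg hA, withDensity_apply _ (measurable_neg hA),
    withDensity_apply _ hA,
    ← (Measure.measurePreserving_neg volume).setLIntegral_comp_preimage hA
      (measurable_jumpDensity hm)]
  simp only [jumpDensity, heatKernel_neg]

lemma lintegral_min_jumpDensity_lt_top (hd : 1 ≤ d) (hφ : IsCompleteBernstein φ a b m)
    (hs : GlobalScaling φ δ δ' C) :
    ∫⁻ x : EuclideanSpace ℝ (Fin d), ENNReal.ofReal (min 1 (‖x‖ ^ 2))
      ∂(volume.withDensity (jumpDensity d m)) < ∞ := by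
  have hd0 : (0 : ℝ) < 2 * d := by
    have : (1 : ℝ) ≤ d := by exact_mod_cast hd
    linarith
  have h1 : ∀ x : EuclideanSpace ℝ (Fin d), ENNReal.ofReal (min 1 (‖x‖ ^ 2)) ≤
      ENNReal.ofReal 2 * ENNReal.ofReal (1 - Real.exp (-‖x‖ ^ 2)) := by
    intro x
    rw [← ENNReal.ofReal_mul (by norm_num)]
    exact ENNReal.ofReal_le_ofReal (min_one_le_two_mul_one_sub_exp_neg (by positivity))
  refine (lintegral_mono h1).trans_lt ?_
  rw [lintegral_const_mul' _ _ ENNReal.ofReal_ne_top,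
    lintegral_withDensity_jumpDensity hφ.completelyMonotone (by fun_prop)
      fun x => one_sub_exp_neg_nonneg (by positivity)]
  refine ENNReal.mul_lt_top ENNReal.ofReal_lt_top (lt_of_le_of_lt ?_
    (ENNReal.ofReal_lt_top (r := φ (2 * d))))
  rw [← hφ.lintegral_densityMeasure hs hd0]
  refine lintegral_mono_ae ?_
  filter_upwards [ae_densityMeasure_pos m] with t ht
  exact lintegral_one_sub_exp_mul_heatKernel_le ht

lemma lintegral_one_sub_cos_jumpDensity (hφ : IsCompleteBernstein φ a b m)
    (hs : GlobalScaling φ δ δ' C) {ξ : EuclideanSpace ℝ (Fin d)} (hξ : ξ ≠ 0) :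
    ∫⁻ x, ENNReal.ofReal (1 - Real.cos ⟪x, ξ⟫) ∂(volume.withDensity (jumpDensity d m)) =
      ENNReal.ofReal (φ (‖ξ‖ ^ 2)) := by
  have hr : 0 < ‖ξ‖ := norm_pos_iff.2 hξ
  rw [lintegral_withDensity_jumpDensity hφ.completelyMonotone (by fun_prop)
      fun x => by linarith [Real.cos_le_one ⟪x, ξ⟫],
    ← hφ.lintegral_densityMeasure hs (by positivity)]
  refine lintegral_congr_ae ?_
  filter_upwards [ae_densityMeasure_pos m] with t ht
  exact lintegral_one_sub_cos_mul_heatKernel ht ξ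

/-- The compensated exponential in the Lévy–Khintchine formula. -/
noncomputable def compensatedExp {E : Type*} [NormedAddCommGroup E] [InnerProductSpace ℝ E]
    (ξ x : E) : ℂ :=
  Complex.exp (Complex.I * (⟪x, ξ⟫ : ℂ)) - 1 -
    Complex.I * (((Metric.closedBall (0 : E) 1).indicator (fun y => ⟪y, ξ⟫) x : ℝ) : ℂ)

/-! ### Symmetry and size of the compensated exponential -/

section CompensatedExp

variable {E : Type*} [NormedAddCommGroup E] [InnerProductSpace ℝ E]

lemma measurable_compensatedExp [MeasurableSpace E] [BorelSpace E] [SecondCountableTopology E]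
    (ξ : E) : Measurable (compensatedExp ξ) := by
  unfold compensatedExp
  have h : Measurable fun x : E => (Metric.closedBall (0 : E) 1).indicator (fun y => ⟪y, ξ⟫) x :=
    (by fun_prop : Measurable fun y : E => ⟪y, ξ⟫).indicator measurableSet_closedBall
  fun_prop

lemma compensatedExp_neg (ξ x : E) :
    compensatedExp ξ (-x) = (starRingEnd ℂ) (compensatedExp ξ x) := by
  have h : (Metric.closedBall (0 : E) 1).indicator (fun y => ⟪y, ξ⟫) (-x) =
      -(Metric.closedBall (0 : E) 1).indicator (fun y => ⟪y, ξ⟫) x := by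
    by_cases hx : x ∈ Metric.closedBall (0 : E) 1
    · have hx' : -x ∈ Metric.closedBall (0 : E) 1 := by simpa using hx
      rw [indicator_of_mem hx, indicator_of_mem hx', inner_neg_left]
    · have hx' : -x ∉ Metric.closedBall (0 : E) 1 := by simpa using hx
      rw [indicator_of_notMem hx, indicator_of_notMem hx', neg_zero]
  rw [compensatedExp, compensatedExp, h]
  simp [← Complex.exp_conj]

lemma compensatedExp_re (ξ x : E) : (compensatedExp ξ x).re = Real.cos ⟪x, ξ⟫ - 1 := by
  simp [compensatedExp, mul_comm Complex.I, Complex.exp_ofReal_mul_I_re]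

/-- Second-order Taylor bound for `|y| ≤ 1`, triangle inequality otherwise. -/
lemma norm_cexp_sub_one_sub_le (y : ℝ) :
    ‖Complex.exp (Complex.I * y) - 1 - Complex.I * y‖ ≤ 3 * y ^ 2 := by
  have hn : ‖Complex.I * (y : ℂ)‖ = |y| := by simp
  rcases le_total |y| 1 with h | h
  · refine (Complex.norm_exp_sub_one_sub_id_le (hn.trans_le h)).trans ?_
    rw [hn, sq_abs]; nlinarith [sq_nonneg y]
  · have h1 : ‖Complex.exp (Complex.I * y)‖ = 1 := by
      rw [mul_comm, Complex.norm_exp_ofReal_mul_I]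
    calc _ ≤ ‖Complex.exp (Complex.I * y)‖ + ‖(1 : ℂ)‖ + ‖Complex.I * (y : ℂ)‖ :=
          (norm_sub_le _ _).trans (add_le_add_left (norm_sub_le _ _) _)
      _ = 2 + |y| := by rw [h1, hn, norm_one]; ring
      _ ≤ 3 * y ^ 2 := by rw [← sq_abs]; nlinarith

lemma norm_compensatedExp_le (ξ x : E) :
    ‖compensatedExp ξ x‖ ≤ (2 + 3 * ‖ξ‖ ^ 2) * min 1 (‖x‖ ^ 2) := by
  by_cases hx : x ∈ Metric.closedBall (0 : E) 1
  · rw [compensatedExp, indicator_of_mem hx]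
    have hx1 : ‖x‖ ≤ 1 := by simpa using hx
    rw [min_eq_right (pow_le_one₀ (norm_nonneg x) hx1)]
    refine (norm_cexp_sub_one_sub_le _).trans ?_
    have h1 : ⟪x, ξ⟫ ^ 2 ≤ (‖x‖ * ‖ξ‖) ^ 2 := by
      rw [← sq_abs]
      exact pow_le_pow_left₀ (abs_nonneg _) (abs_real_inner_le_norm x ξ) 2
    nlinarith [sq_nonneg ‖x‖]
  · rw [compensatedExp, indicator_of_notMem hx]
    have hx1 : 1 < ‖x‖ := by simpa using hx
    rw [min_eq_left (one_le_pow₀ hx1.le), Complex.ofReal_zero, mul_zero, sub_zero, mul_one]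
    refine (norm_sub_le _ _).trans ?_
    rw [mul_comm, Complex.norm_exp_ofReal_mul_I, norm_one]
    nlinarith [sq_nonneg ‖ξ‖]

end CompensatedExp

lemma integrable_compensatedExp (hd : 1 ≤ d) (hφ : IsCompleteBernstein φ a b m)
    (hs : GlobalScaling φ δ δ' C) (ξ : EuclideanSpace ℝ (Fin d)) :
    Integrable (compensatedExp ξ) (volume.withDensity (jumpDensity d m)) := by
  have hi : Integrable (fun x : EuclideanSpace ℝ (Fin d) => min 1 (‖x‖ ^ 2))
      (volume.withDensity (jumpDensity d m)) := by
    refine ⟨(by fun_prop : Measurable fun x : EuclideanSpace ℝ (Fin d) =>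
      min 1 (‖x‖ ^ 2)).aestronglyMeasurable, ?_⟩
    rw [hasFiniteIntegral_iff_ofReal (Eventually.of_forall fun x => by positivity)]
    exact lintegral_min_jumpDensity_lt_top hd hφ hs
  exact (hi.const_mul _).mono' (measurable_compensatedExp ξ).aestronglyMeasurable
    (Eventually.of_forall (norm_compensatedExp_le ξ))

lemma integral_compensatedExp (hd : 1 ≤ d) (hφ : IsCompleteBernstein φ a b m)
    (hs : GlobalScaling φ δ δ' C) {ξ : EuclideanSpace ℝ (Fin d)} (hξ : ξ ≠ 0) :
    ∫ x, compensatedExp ξ x ∂(volume.withDensity (jumpDensity d m)) =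
      ((-φ (‖ξ‖ ^ 2) : ℝ) : ℂ) := by
  have hr : 0 < ‖ξ‖ := norm_pos_iff.2 hξ
  apply Complex.ext
  · rw [Complex.ofReal_re]
    have h1 := integral_re (integrable_compensatedExp hd hφ hs ξ)
    simp only [RCLike.re_to_complex, compensatedExp_re] at h1
    rw [← h1]
    have h2 : ∀ x : EuclideanSpace ℝ (Fin d), Real.cos ⟪x, ξ⟫ - 1 = -(1 - Real.cos ⟪x, ξ⟫) :=
      fun x => by ring
    simp_rw [h2]
    rw [integral_neg, integral_eq_lintegral_of_nonneg_ae
      (Eventually.of_forall fun x => by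
        simpa using Real.cos_le_one ⟪x, ξ⟫)
      (by fun_prop : Measurable fun x : EuclideanSpace ℝ (Fin d) =>
        1 - Real.cos ⟪x, ξ⟫).aestronglyMeasurable,
      lintegral_one_sub_cos_jumpDensity hφ hs hξ,
      ENNReal.toReal_ofReal (hφ.pos _ (by positivity)).le]
  · rw [Complex.ofReal_im]
    -- Reflection conjugates the integrand and preserves the measure, so the integral equals its own
    -- conjugate. The cut-off to the unit ball thus contributes no drift.
    have h1 := (measurePreserving_neg_jumpDensity (d := d) hφ.completelyMonotone).integral_comp
      (MeasurableEquiv.neg _).measurableEmbedding (compensatedExp ξ)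
    simp only [compensatedExp_neg] at h1
    rw [integral_conj] at h1
    exact Complex.conj_eq_iff_im.1 h1

theorem isLevyMeasure_jumpDensity {Ω : Type*} [MeasurableSpace Ω] {P : Measure Ω}
    (hd : 1 ≤ d) (hφ : IsCompleteBernstein φ a b m) (hs : GlobalScaling φ δ δ' C)
    {X : ℝ≥0 → Ω → EuclideanSpace ℝ (Fin d)}
    (hX : ∀ (t : ℝ≥0) (ξ : EuclideanSpace ℝ (Fin d)), ξ ≠ 0 →
      charFun (P.map (X t)) ξ = Complex.exp (-(t * φ (‖ξ‖ ^ 2))))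
    (hX0 : ∀ t : ℝ≥0, charFun (P.map (X t)) 0 = 1) :
    IsLevyMeasure P X (volume.withDensity (jumpDensity d m)) := by
  -- In positive dimension Lebesgue measure has no atom at 0.
  have : Nonempty (Fin d) := ⟨⟨0, hd⟩⟩
  refine ⟨withDensity_absolutelyContinuous _ _ (measure_singleton 0),
    lintegral_min_jumpDensity_lt_top hd hφ hs, 0, 0, ContinuousLinearMap.isPositive_zero,
    fun t ξ => ?_⟩
  -- The value `φ 0` is unconstrained, so the zero frequency is treated apart.
  by_cases hξ : ξ = 0
  · subst hξ
    simp [hX0]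
  · have h := integral_compensatedExp hd hφ hs hξ
    unfold compensatedExp at h
    rw [hX t ξ hξ, h]
    simp

end LevyMeasure

/-! ### Jointly measurable versions of right-continuous processes -/

section Discretize

/-- The least multiple of `1 / (n + 1)` which is strictly larger than `t`. -/
noncomputable def gridPoint (n k : ℕ) : ℝ≥0 := ((k : ℝ≥0) + 1) / ((n : ℝ≥0) + 1)

/-- The index of the last multiple of `1 / (n + 1)` before `t`. -/
noncomputable def gridIndex (n : ℕ) (t : ℝ≥0) : ℕ := ⌊((n : ℝ≥0) + 1) * t⌋₊

lemma measurable_gridIndex (n : ℕ) : Measurable (gridIndex n) :=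
  Nat.measurable_floor.comp (measurable_const_mul _)

lemma le_gridPoint (n : ℕ) (t : ℝ≥0) : t ≤ gridPoint n (gridIndex n t) := by
  rw [gridPoint, le_div_iff₀ (by positivity), mul_comm]
  exact (Nat.lt_floor_add_one _).le

lemma gridPoint_le (n : ℕ) (t : ℝ≥0) : gridPoint n (gridIndex n t) ≤ t + 1 / ((n : ℝ≥0) + 1) := by
  rw [gridPoint, div_le_iff₀ (by positivity), add_mul, div_mul_cancel₀ _ (by positivity), mul_comm t]
  gcongr
  exact Nat.floor_le (by positivity)

lemma tendsto_gridPoint (t : ℝ≥0) :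
    Tendsto (fun n => gridPoint n (gridIndex n t)) atTop (𝓝 t) := by
  refine tendsto_of_tendsto_of_tendsto_of_le_of_le tendsto_const_nhds ?_
    (fun n => le_gridPoint n t) (fun n => gridPoint_le n t)
  have h : Tendsto (fun n : ℕ => 1 / ((n : ℝ≥0) + 1)) atTop (𝓝 0) := by
    rw [← NNReal.tendsto_coe]
    push_cast
    exact tendsto_one_div_add_atTop_nhds_zero_nat
  simpa using h.const_add t

lemma tendsto_gridPoint_right (t : ℝ≥0) :
    Tendsto (fun n => gridPoint n (gridIndex n t)) atTop (𝓝[≥] t) :=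
  tendsto_nhdsWithin_iff.2 ⟨tendsto_gridPoint t, Eventually.of_forall fun n => le_gridPoint n t⟩

end Discretize

section Subordination

variable {Ω : Type*} [MeasurableSpace Ω] {P : Measure Ω}

/-- Sampling at the next grid point to the right is jointly measurable, since only countably many
times occur, and converges by right-continuity. -/
lemma measurable_uncurry_of_rightContinuous {F : Type*} [TopologicalSpace F]
    [TopologicalSpace.PseudoMetrizableSpace F] [MeasurableSpace F] [BorelSpace F]
    {X : ℝ≥0 → Ω → F} (hX : ∀ t, Measurable (X t))
    (hc : ∀ ω t, ContinuousWithinAt (fun s => X s ω) (Ici t) t) :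
    Measurable (Function.uncurry X) := by
  have hmeas : ∀ n, Measurable fun p : ℝ≥0 × Ω => X (gridPoint n (gridIndex n p.1)) p.2 := by
    intro n
    have h : Measurable fun q : ℕ × Ω => X (gridPoint n q.1) q.2 :=
      measurable_from_prod_countable_right fun k => hX (gridPoint n k)
    have h2 : Measurable fun p : ℝ≥0 × Ω => (gridIndex n p.1, p.2) :=
      ((measurable_gridIndex n).comp measurable_fst).prodMk measurable_snd
    have h3 := h.comp h2
    simpa only [Function.comp_def] using h3
  refine measurable_of_tendsto_metrizable hmeas (tendsto_pi_nhds.2 fun p => ?_)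
  have h := (hc p.2 p.1).tendsto
  exact Tendsto.comp h (tendsto_gridPoint_right p.1)

lemma exists_measurable_version {F : Type*} [TopologicalSpace F] [Zero F]
    [TopologicalSpace.PseudoMetrizableSpace F] [MeasurableSpace F] [BorelSpace F]
    {X : ℝ≥0 → Ω → F} (hX : ∀ t, Measurable (X t))
    (hc : ∀ᵐ ω ∂P, ∀ t, ContinuousWithinAt (fun s => X s ω) (Ici t) t) :
    ∃ Y : ℝ≥0 → Ω → F, Measurable (Function.uncurry Y) ∧ ∀ᵐ ω ∂P, ∀ t, Y t ω = X t ω := by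
  classical
  -- The set of bad paths need not be measurable; a measurable null set containing it is used, and
  -- paths in it are replaced by 0.
  set N := toMeasurable P {ω | ¬ ∀ t, ContinuousWithinAt (fun s => X s ω) (Ici t) t} with hN
  have hNm : MeasurableSet N := measurableSet_toMeasurable _ _
  have hN0 : P N = 0 := by rw [hN, measure_toMeasurable]; exact ae_iff.1 hc
  refine ⟨fun t => N.piecewise (fun _ => 0) (X t),
    measurable_uncurry_of_rightContinuous
      (fun t => Measurable.piecewise hNm measurable_const (hX t)) fun ω t => ?_, ?_⟩
  · by_cases hω : ω ∈ N
    · simp only [piecewise_eq_of_mem _ _ _ hω]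
      exact continuousWithinAt_const
    · simp only [piecewise_eq_of_notMem _ _ _ hω]
      by_contra h
      exact hω (subset_toMeasurable _ _ fun h' => h (h' t))
  · filter_upwards [measure_eq_zero_iff_ae_notMem.1 hN0] with ω hω t
    exact piecewise_eq_of_notMem _ _ _ hω

/-! ### Evaluation of a process at an independent random time -/

/-- A countable index makes evaluation `(n, v) ↦ v n` measurable for the product σ-algebra, so
independence and Fubini apply directly. -/
lemma integral_comp_indep_index {F : Type*} [MeasurableSpace F] [IsProbabilityMeasure P]
    {N : Ω → ℕ} (hN : Measurable N) {V : ℕ → Ω → F} (hV : ∀ n, Measurable (V n))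
    (hind : IndepFun N (fun ω n => V n ω) P) {f : F → ℂ} (hf : Measurable f)
    (hb : ∀ x, ‖f x‖ ≤ 1) :
    ∫ ω, f (V (N ω) ω) ∂P = ∫ ω, (∫ ω', f (V (N ω) ω') ∂P) ∂P := by
  have hV' : Measurable fun ω n => V n ω := measurable_pi_lambda _ hV
  have hF : Measurable fun p : ℕ × (ℕ → F) => f (p.2 p.1) :=
    measurable_from_prod_countable_right fun n => hf.comp (measurable_pi_apply n)
  have hprod := (indepFun_iff_map_prod_eq_prod_map_map hN.aemeasurable hV'.aemeasurable).1 hind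
  have h1 : ∫ ω, f (V (N ω) ω) ∂P =
      ∫ p, f (p.2 p.1) ∂(P.map fun ω => (N ω, fun n => V n ω)) :=
    (integral_map (φ := fun ω => (N ω, fun n => V n ω)) (hN.prodMk hV').aemeasurable
      hF.aestronglyMeasurable).symm
  have := Measure.isProbabilityMeasure_map (μ := P) hN.aemeasurable
  have := Measure.isProbabilityMeasure_map (μ := P) hV'.aemeasurable
  have hint : Integrable (fun p : ℕ × (ℕ → F) => f (p.2 p.1))
      ((P.map N).prod (P.map fun ω n => V n ω)) :=
    (integrable_const (1 : ℝ)).mono' hF.aestronglyMeasurable (Eventually.of_forall fun p => hb _)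
  rw [h1, hprod, integral_prod _ hint, integral_map hN.aemeasurable
    (measurable_of_countable _).aestronglyMeasurable]
  refine integral_congr_ae (Eventually.of_forall fun ω => ?_)
  exact integral_map hV'.aemeasurable
    (hf.comp (measurable_pi_apply (N ω))).aestronglyMeasurable

/-- Evaluation of a path at an arbitrary real time is not measurable for the product σ-algebra. The
time is therefore rounded up to a grid, the countable case applied, and the mesh sent to 0 by
dominated convergence: continuity of paths handles the left side, and continuity of `t ↦ E f(W_t)`
the right. -/
lemma integral_comp_indep_time {F : Type*} [TopologicalSpace F] [MeasurableSpace F] [BorelSpace F]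
    [IsProbabilityMeasure P]
    {T : Ω → ℝ≥0} (hT : Measurable T) {W : ℝ≥0 → Ω → F} (hW : ∀ t, Measurable (W t))
    (hc : ∀ᵐ ω ∂P, Continuous fun t => W t ω)
    (hind : IndepFun T (fun ω t => W t ω) P) {f : F → ℂ} (hf : Continuous f)
    (hb : ∀ x, ‖f x‖ ≤ 1) (hg : Continuous fun t => ∫ ω, f (W t ω) ∂P) :
    ∫ ω, f (W (T ω) ω) ∂P = ∫ ω, (∫ ω', f (W (T ω) ω') ∂P) ∂P := by
  have hgb : ∀ t, ‖∫ ω, f (W t ω) ∂P‖ ≤ 1 := fun t =>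
    (norm_integral_le_of_norm_le_const (Eventually.of_forall fun ω => hb _)).trans (by simp)
  have hdisc : ∀ n, ∫ ω, f (W (gridPoint n (gridIndex n (T ω))) ω) ∂P =
      ∫ ω, (∫ ω', f (W (gridPoint n (gridIndex n (T ω))) ω') ∂P) ∂P := by
    intro n
    refine integral_comp_indep_index (N := fun ω => gridIndex n (T ω))
      (V := fun k => W (gridPoint n k)) ((measurable_gridIndex n).comp hT) (fun k => hW _) ?_
      hf.measurable hb
    exact hind.comp (φ := gridIndex n) (ψ := fun w k => w (gridPoint n k))
      (measurable_gridIndex n)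
      (measurable_pi_lambda _ fun k => measurable_pi_apply (gridPoint n k))
  have hl : Tendsto (fun n => ∫ ω, f (W (gridPoint n (gridIndex n (T ω))) ω) ∂P) atTop
      (𝓝 (∫ ω, f (W (T ω) ω) ∂P)) := by
    refine tendsto_integral_of_dominated_convergence (fun _ => 1) (fun n => ?_)
      (integrable_const _) (fun n => Eventually.of_forall fun ω => hb _) ?_
    · have h : Measurable fun q : ℕ × Ω => W (gridPoint n q.1) q.2 :=
        measurable_from_prod_countable_right fun k => hW (gridPoint n k)
      exact (hf.measurable.comp (h.comp
        (((measurable_gridIndex n).comp hT).prodMk measurable_id))).aestronglyMeasurable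
    · filter_upwards [hc] with ω hω
      exact ((hf.comp hω).tendsto _).comp (tendsto_gridPoint (T ω))
  have hr : Tendsto (fun n => ∫ ω, (∫ ω', f (W (gridPoint n (gridIndex n (T ω))) ω') ∂P) ∂P) atTop
      (𝓝 (∫ ω, (∫ ω', f (W (T ω) ω') ∂P) ∂P)) := by
    refine tendsto_integral_of_dominated_convergence (fun _ => 1) (fun n => ?_)
      (integrable_const _) (fun n => Eventually.of_forall fun ω => hgb _)
      (Eventually.of_forall fun ω => ?_)
    · have h : Measurable fun k : ℕ => ∫ ω', f (W (gridPoint n k) ω') ∂P :=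
        measurable_of_countable _
      exact (h.comp ((measurable_gridIndex n).comp hT)).aestronglyMeasurable
    · exact (hg.tendsto _).comp (tendsto_gridPoint (T ω))
  simp_rw [hdisc] at hl
  exact tendsto_nhds_unique hl hr

/-! ### The subordinate process -/

variable {d : ℕ} {φ m : ℝ → ℝ} {a b δ δ' C : ℝ} {S : ℝ≥0 → Ω → ℝ≥0}
  {W : ℝ≥0 → Ω → EuclideanSpace ℝ (Fin d)}

lemma IsSubordinator.measurable (hS : IsSubordinator P S φ) (t : ℝ≥0) : Measurable (S t) := by
  simpa using (hS.levy.measurable t).real_toNNReal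

lemma IsSubordinator.exists_version (hS : IsSubordinator P S φ) :
    ∃ S' : ℝ≥0 → Ω → ℝ≥0, Measurable (Function.uncurry S') ∧ ∀ᵐ ω ∂P, ∀ t, S' t ω = S t ω := by
  refine exists_measurable_version hS.measurable ?_
  filter_upwards [hS.levy.cadlag] with ω hω t
  have := (hω t).1.tendsto
  exact NNReal.tendsto_coe.1 this

lemma IsBrownianMotion.exists_version (hW : IsBrownianMotion P W) :
    ∃ W' : ℝ≥0 → Ω → EuclideanSpace ℝ (Fin d), Measurable (Function.uncurry W') ∧
      ∀ᵐ ω ∂P, ∀ t, W' t ω = W t ω := by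
  refine exists_measurable_version hW.levy.measurable ?_
  filter_upwards [hW.continuous] with ω hω t
  exact hω.continuousWithinAt

lemma exists_subordinate_version (hS : IsSubordinator P S φ) (hW : IsBrownianMotion P W) :
    ∃ X : ℝ≥0 → Ω → EuclideanSpace ℝ (Fin d), Measurable (Function.uncurry X) ∧
      ∀ᵐ ω ∂P, ∀ t, X t ω = subordinate W S t ω := by
  obtain ⟨S', hS', hSS'⟩ := hS.exists_version
  obtain ⟨W', hW', hWW'⟩ := hW.exists_version
  refine ⟨fun t ω => W' (S' t ω) ω, hW'.comp (hS'.prodMk measurable_snd), ?_⟩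
  filter_upwards [hSS', hWW'] with ω h1 h2 t
  rw [h1, h2, subordinate]

lemma aemeasurable_subordinate (hS : IsSubordinator P S φ) (hW : IsBrownianMotion P W) (t : ℝ≥0) :
    AEMeasurable (subordinate W S t) P := by
  obtain ⟨X, hX, h⟩ := exists_subordinate_version hS hW
  exact ⟨X t, hX.comp (measurable_const.prodMk measurable_id), h.mono fun ω hω => (hω t).symm⟩

lemma charFun_subordinate [IsProbabilityMeasure P] (hS : IsSubordinator P S φ)
    (hW : IsBrownianMotion P W) (hSW : IndepFun (fun ω t => S t ω) (fun ω t => W t ω) P)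
    (t : ℝ≥0) (ξ : EuclideanSpace ℝ (Fin d)) :
    charFun (P.map (subordinate W S t)) ξ =
      ((∫ ω, Real.exp (-(‖ξ‖ ^ 2 * S t ω)) ∂P : ℝ) : ℂ) := by
  have hf : Continuous fun x : EuclideanSpace ℝ (Fin d) => Complex.exp (⟪x, ξ⟫ * Complex.I) := by
    fun_prop
  have hg : ∀ s : ℝ≥0, ∫ ω, Complex.exp (⟪W s ω, ξ⟫ * Complex.I) ∂P =
      ((Real.exp (-(‖ξ‖ ^ 2 * s)) : ℝ) : ℂ) := by
    intro s
    have h := hW.charFun_eq s ξ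
    rw [charFun_apply, integral_map (hW.levy.measurable s).aemeasurable
      hf.aestronglyMeasurable] at h
    rw [h]
    push_cast
    ring_nf
  rw [charFun_apply, integral_map (aemeasurable_subordinate hS hW t) hf.aestronglyMeasurable]
  have h := integral_comp_indep_time (hS.measurable t) hW.levy.measurable hW.continuous
    (hSW.comp (measurable_pi_apply t) measurable_id) hf
    (fun x => (Complex.norm_exp_ofReal_mul_I _).le)
    (by simp_rw [hg]; fun_prop)
  simp_rw [hg] at h
  unfold subordinate
  rw [h, integral_complex_ofReal]

lemma charFun_subordinate_of_ne_zero [IsProbabilityMeasure P] (hS : IsSubordinator P S φ)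
    (hW : IsBrownianMotion P W) (hSW : IndepFun (fun ω t => S t ω) (fun ω t => W t ω) P)
    (t : ℝ≥0) (ξ : EuclideanSpace ℝ (Fin d)) (hξ : ξ ≠ 0) :
    charFun (P.map (subordinate W S t)) ξ = Complex.exp (-(t * φ (‖ξ‖ ^ 2))) := by
  have hr : 0 < ‖ξ‖ := norm_pos_iff.2 hξ
  rw [charFun_subordinate hS hW hSW, hS.laplace t _ (by positivity)]
  push_cast
  rfl

lemma charFun_subordinate_zero [IsProbabilityMeasure P] (hS : IsSubordinator P S φ)
    (hW : IsBrownianMotion P W) (hSW : IndepFun (fun ω t => S t ω) (fun ω t => W t ω) P)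
    (t : ℝ≥0) : charFun (P.map (subordinate W S t)) 0 = 1 := by
  rw [charFun_subordinate hS hW hSW]
  simp

/-! ### Positivity of the subordinator and the law of the subordinate process -/

lemma IsCompleteBernstein.tendsto_atTop (hφ : IsCompleteBernstein φ a b m)
    (hs : GlobalScaling φ δ δ' C) : Tendsto φ atTop atTop := by
  have hC := hs.const_pos
  have h1 := hφ.pos 1 one_pos
  refine tendsto_atTop_mono' atTop ?_
    ((tendsto_rpow_atTop hs.lower_exponent_pos).const_mul_atTop (div_pos h1 hC))
  filter_upwards [eventually_ge_atTop 1] with l hl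
  have hl0 : 0 < l := by linarith
  have h2 := hs.lower 1 l one_pos hl
  have h3 : 0 < l ^ δ := Real.rpow_pos_of_pos hl0 _
  rw [one_div, Real.inv_rpow hl0.le] at h2
  calc φ 1 / C * l ^ δ ≤ (C * (l ^ δ)⁻¹ * φ l) / C * l ^ δ := by gcongr
    _ = φ l := by field_simp

/-- `P(S_t = 0) ≤ E exp(-l S_t) = exp(-t φ(l))`, and `φ` is unbounded. Hence the law of `X_t` has no
singular part at 0. -/
lemma IsSubordinator.ae_pos [IsProbabilityMeasure P] (hS : IsSubordinator P S φ)
    (hφ : IsCompleteBernstein φ a b m) (hs : GlobalScaling φ δ δ' C) {t : ℝ≥0} (ht : 0 < t) :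
    ∀ᵐ ω ∂P, 0 < S t ω := by
  have hm := hS.measurable t
  have hA : MeasurableSet {ω | S t ω = 0} := hm (measurableSet_singleton 0)
  have h1 : ∀ l : ℝ, 0 < l → P.real {ω | S t ω = 0} ≤ Real.exp (-((t : ℝ) * φ l)) := by
    intro l hl
    have hexp : Measurable fun ω => Real.exp (-(l * (S t ω : ℝ))) := by fun_prop
    rw [← hS.laplace t l hl, ← integral_indicator_one hA]
    refine integral_mono ((integrable_const (1 : ℝ)).indicator hA)
      ((integrable_const (1 : ℝ)).mono' hexp.aestronglyMeasurable
        (Eventually.of_forall fun ω => ?_)) fun ω => ?_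
    · rw [Real.norm_of_nonneg (Real.exp_pos _).le]
      exact Real.exp_le_one_iff.2 (neg_nonpos.2 (by positivity))
    · by_cases hω : S t ω = 0
      · simp [hω]
      · rw [indicator_of_notMem (by simpa using hω)]
        positivity
  have h2 : Tendsto (fun l => Real.exp (-((t : ℝ) * φ l))) atTop (𝓝 0) :=
    Real.tendsto_exp_neg_atTop_nhds_zero.comp
      ((hφ.tendsto_atTop hs).const_mul_atTop (by exact_mod_cast ht))
  have h3 : P.real {ω | S t ω = 0} ≤ 0 :=
    ge_of_tendsto h2 ((eventually_gt_atTop 0).mono h1)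
  have h4 : P {ω | S t ω = 0} = 0 :=
    (measureReal_eq_zero_iff).1 (le_antisymm h3 measureReal_nonneg)
  filter_upwards [measure_eq_zero_iff_ae_notMem.1 h4] with ω hω
  exact pos_iff_ne_zero.2 hω

lemma lintegral_heatKernel_mixture (ρ : Measure ℝ) [SFinite ρ]
    {f : EuclideanSpace ℝ (Fin d) → ℝ≥0∞} (hf : Measurable f) :
    ∫⁻ x, f x ∂(volume.withDensity fun x => ∫⁻ s, ENNReal.ofReal (heatKernel d s x) ∂ρ) =
      ∫⁻ p, f p.2 ∂((ρ.prod volume).withDensity fun p => ENNReal.ofReal (heatKernel d p.1 p.2)) := by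
  have hq := (measurable_heatKernel (d := d)).ennreal_ofReal
  have hD : Measurable fun x => ∫⁻ s, ENNReal.ofReal (heatKernel d s x) ∂ρ :=
    Measurable.lintegral_prod_right'
      (f := fun p : EuclideanSpace ℝ (Fin d) × ℝ => ENNReal.ofReal (heatKernel d p.2 p.1))
      (hq.comp measurable_swap)
  have hf2 : Measurable fun p : ℝ × EuclideanSpace ℝ (Fin d) => f p.2 := hf.comp measurable_snd
  rw [lintegral_withDensity_eq_lintegral_mul _ hD hf,
    lintegral_withDensity_eq_lintegral_mul _ hq hf2, lintegral_prod_symm' _ (hq.mul hf2)]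
  refine lintegral_congr fun x => ?_
  simp only [Pi.mul_apply]
  have hqx : Measurable fun s => ENNReal.ofReal (heatKernel d s x) :=
    hq.comp (measurable_id.prodMk measurable_const)
  rw [lintegral_mul_const _ hqx]

lemma isProbabilityMeasure_heatKernel_prod (ρ : Measure ℝ) [IsProbabilityMeasure ρ]
    (hρ : ∀ᵐ s ∂ρ, 0 < s) : IsProbabilityMeasure
      ((ρ.prod (volume : Measure (EuclideanSpace ℝ (Fin d)))).withDensity
        fun p => ENNReal.ofReal (heatKernel d p.1 p.2)) := by
  constructor
  rw [withDensity_apply _ MeasurableSet.univ, setLIntegral_univ,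
    lintegral_prod _ measurable_heatKernel.ennreal_ofReal.aemeasurable]
  rw [lintegral_congr_ae (g := fun _ => 1) (hρ.mono fun s hs => lintegral_heatKernel hs)]
  simp

/-- The mixture is a marginal of a joint law with finite density. Complex integrals are computed on
the joint law, where it does not matter that the mixed density may take the value `∞`. -/
lemma heatKernel_mixture_eq_map (ρ : Measure ℝ) [SFinite ρ] :
    (volume : Measure (EuclideanSpace ℝ (Fin d))).withDensity
        (fun x => ∫⁻ s, ENNReal.ofReal (heatKernel d s x) ∂ρ) =
      ((ρ.prod volume).withDensity fun p => ENNReal.ofReal (heatKernel d p.1 p.2)).map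
        Prod.snd := by
  refine Measure.ext fun A hA => ?_
  have h := lintegral_heatKernel_mixture (d := d) ρ (measurable_one.indicator hA)
  rw [lintegral_indicator_one hA] at h
  rw [h, Measure.map_apply measurable_snd hA, ← lintegral_indicator_one (measurable_snd hA)]
  rfl

lemma charFun_heatKernel_mixture (ρ : Measure ℝ) [IsProbabilityMeasure ρ]
    (hρ : ∀ᵐ s ∂ρ, 0 < s) (ξ : EuclideanSpace ℝ (Fin d)) :
    charFun (volume.withDensity fun x => ∫⁻ s, ENNReal.ofReal (heatKernel d s x) ∂ρ) ξ =
      ((∫ s, Real.exp (-(‖ξ‖ ^ 2 * s)) ∂ρ : ℝ) : ℂ) := by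
  have hprob := isProbabilityMeasure_heatKernel_prod (d := d) ρ hρ
  have hf : Continuous fun x : EuclideanSpace ℝ (Fin d) => Complex.exp (⟪x, ξ⟫ * Complex.I) := by
    fun_prop
  have hint : Integrable (fun p : ℝ × EuclideanSpace ℝ (Fin d) =>
      Complex.exp (⟪p.2, ξ⟫ * Complex.I))
      ((ρ.prod volume).withDensity fun p => ENNReal.ofReal (heatKernel d p.1 p.2)) :=
    (integrable_const (1 : ℝ)).mono' (hf.comp continuous_snd).aestronglyMeasurable
      (Eventually.of_forall fun p => (Complex.norm_exp_ofReal_mul_I _).le)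
  have hq := (measurable_heatKernel (d := d)).ennreal_ofReal
  have hfin : ∀ᵐ p ∂(ρ.prod (volume : Measure (EuclideanSpace ℝ (Fin d)))),
      ENNReal.ofReal (heatKernel d p.1 p.2) < ∞ :=
    Eventually.of_forall fun p => ENNReal.ofReal_lt_top
  rw [integrable_withDensity_iff_integrable_smul' hq hfin] at hint
  rw [charFun_apply, heatKernel_mixture_eq_map,
    integral_map measurable_snd.aemeasurable hf.aestronglyMeasurable,
    integral_withDensity_eq_integral_toReal_smul hq hfin, integral_prod _ hint,
    ← integral_complex_ofReal]
  refine integral_congr_ae (hρ.mono fun s hs => ?_)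
  have h := integral_cexp_mul_heatKernel hs ξ
  simp only
  calc _ = ∫ x : EuclideanSpace ℝ (Fin d),
        Complex.exp (⟪x, ξ⟫ * Complex.I) * (heatKernel d s x : ℂ) := by
        refine integral_congr_ae (Eventually.of_forall fun x => ?_)
        simp only
        rw [ENNReal.toReal_ofReal (heatKernel_nonneg hs.le x), Complex.real_smul, mul_comm]
    _ = _ := by
        rw [h]; push_cast; ring_nf

lemma map_subordinate_eq [IsProbabilityMeasure P] (hφ : IsCompleteBernstein φ a b m)
    (hs : GlobalScaling φ δ δ' C) (hS : IsSubordinator P S φ)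
    (hW : IsBrownianMotion P W) (hSW : IndepFun (fun ω t => S t ω) (fun ω t => W t ω) P)
    {t : ℝ≥0} (ht : 0 < t) :
    P.map (subordinate W S t) = volume.withDensity (transitionDensity d P S t) := by
  have hmS : Measurable fun ω => (S t ω : ℝ) := hS.levy.measurable t
  have hpos : ∀ᵐ s ∂(P.map fun ω => (S t ω : ℝ)), 0 < s :=
    (ae_map_iff hmS.aemeasurable measurableSet_Ioi).2
      ((hS.ae_pos hφ hs ht).mono fun ω hω => by exact_mod_cast hω)
  have hρ : (P.map fun ω => (S t ω : ℝ)).restrict (Ioi 0) = P.map fun ω => (S t ω : ℝ) :=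
    Measure.restrict_eq_self_of_ae_mem hpos
  have := Measure.isProbabilityMeasure_map (μ := P) hmS.aemeasurable
  have := Measure.isProbabilityMeasure_map (μ := P) (aemeasurable_subordinate hS hW t)
  have hp : transitionDensity d P S t = fun x =>
      ∫⁻ s, ENNReal.ofReal (heatKernel d s x) ∂(P.map fun ω => (S t ω : ℝ)) := by
    funext x
    rw [transitionDensity, hρ]
  rw [hp]
  have hprob := isProbabilityMeasure_heatKernel_prod (d := d) _ hpos
  have : IsProbabilityMeasure ((volume : Measure (EuclideanSpace ℝ (Fin d))).withDensity fun x =>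
      ∫⁻ s, ENNReal.ofReal (heatKernel d s x) ∂(P.map fun ω => (S t ω : ℝ))) := by
    rw [heatKernel_mixture_eq_map]
    exact Measure.isProbabilityMeasure_map measurable_snd.aemeasurable
  refine Measure.ext_of_charFun (funext fun ξ => ?_)
  rw [charFun_subordinate hS hW hSW, charFun_heatKernel_mixture _ hpos,
    integral_map hmS.aemeasurable (by fun_prop)]

end Subordination

/-! ### Measures with Laplace transform `1 / φ` -/

section Potential

variable {d : ℕ} {φ m : ℝ → ℝ} {a b δ δ' C : ℝ} {U : Measure ℝ}

lemma lintegral_Ioc_rpow {p ρ : ℝ} (hp : 0 < p) (hρ : 0 ≤ ρ) :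
    ∫⁻ l in Ioc 0 ρ, ENNReal.ofReal (l ^ (p - 1)) = ENNReal.ofReal (ρ ^ p / p) := by
  have hi : IntervalIntegrable (fun l : ℝ => l ^ (p - 1)) volume 0 ρ :=
    intervalIntegral.intervalIntegrable_rpow' (by linarith)
  rw [← ofReal_integral_eq_lintegral_ofReal
    ((intervalIntegrable_iff_integrableOn_Ioc_of_le hρ).1 hi)
    ((ae_restrict_iff' measurableSet_Ioc).2
      (Eventually.of_forall fun l hl => Real.rpow_nonneg hl.1.le _)),
    ← intervalIntegral.integral_of_le hρ, integral_rpow (Or.inl (by linarith))]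
  simp [Real.zero_rpow hp.ne']

/-- On `0 < l ≤ min ρ s⁻¹` one has `exp(-ls) ≥ exp(-1)`, and the integral of `l^(p-1)` over this
range is the `p`-th power divided by `p`. -/
lemma ofReal_min_rpow_le {p ρ s : ℝ} (hp : 0 < p) (hρ : 0 < ρ) (hs : 0 < s) :
    ENNReal.ofReal ((min ρ s⁻¹) ^ p) ≤ ENNReal.ofReal (p * Real.exp 1) *
      ∫⁻ l in Ioc 0 ρ, ENNReal.ofReal (l ^ (p - 1) * Real.exp (-(l * s))) := by
  set r := min ρ s⁻¹ with hr
  have hr0 : 0 < r := lt_min hρ (inv_pos.2 hs)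
  have hrs : r * s ≤ 1 := by
    calc r * s ≤ s⁻¹ * s := by gcongr; exact min_le_right _ _
      _ = 1 := inv_mul_cancel₀ hs.ne'
  have h1 : ENNReal.ofReal (Real.exp (-1)) * ENNReal.ofReal (r ^ p / p) ≤
      ∫⁻ l in Ioc 0 ρ, ENNReal.ofReal (l ^ (p - 1) * Real.exp (-(l * s))) := by
    rw [← lintegral_Ioc_rpow hp hr0.le, ← lintegral_const_mul' _ _ ENNReal.ofReal_ne_top]
    calc _ ≤ ∫⁻ l in Ioc 0 r, ENNReal.ofReal (l ^ (p - 1) * Real.exp (-(l * s))) := by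
          refine setLIntegral_mono' measurableSet_Ioc fun l hl => ?_
          rw [← ENNReal.ofReal_mul (Real.exp_pos _).le, mul_comm]
          have : 0 ≤ l ^ (p - 1) := Real.rpow_nonneg hl.1.le _
          have : l * s ≤ 1 := (mul_le_mul_of_nonneg_right hl.2 hs.le).trans hrs
          gcongr
      _ ≤ _ := lintegral_mono_set (Ioc_subset_Ioc_right (min_le_left _ _))
  refine le_trans (le_of_eq ?_) (mul_le_mul_right h1 _)
  rw [← ENNReal.ofReal_mul (Real.exp_pos _).le, ← ENNReal.ofReal_mul (by positivity)]
  congr 1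
  rw [Real.exp_neg]
  field_simp

/-- After Tonelli the inner integral is `l^(p-1) / φ(l)`. Upper scaling compares `φ l` with `φ ρ`
and leaves `l^(p-δ'-1)`, integrable at 0 because `δ' < p`. -/
lemma lintegral_min_rpow_le [SFinite U] (hφ : IsCompleteBernstein φ a b m)
    (hs : GlobalScaling φ δ δ' C) (hU : ∀ᵐ s ∂U, 0 < s)
    (hL : ∀ l : ℝ, 0 < l → ∫⁻ s, ENNReal.ofReal (Real.exp (-(l * s))) ∂U = ENNReal.ofReal (φ l)⁻¹)
    {p ρ : ℝ} (hp : 0 < p) (hpδ : δ' < p) (hρ : 0 < ρ) :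
    ∫⁻ s, ENNReal.ofReal ((min ρ s⁻¹) ^ p) ∂U ≤
      ENNReal.ofReal (p * Real.exp 1 * (C / (p - δ')) * (ρ ^ p * (φ ρ)⁻¹)) := by
  have hC := hs.const_pos
  have hφρ := hφ.pos ρ hρ
  have hpd : 0 < p - δ' := sub_pos.2 hpδ
  have hmeas : Measurable fun q : ℝ × ℝ =>
      ENNReal.ofReal (q.2 ^ (p - 1) * Real.exp (-(q.2 * q.1))) := by fun_prop
  have hinner : ∀ l ∈ Ioc 0 ρ,
      ∫⁻ s, ENNReal.ofReal (l ^ (p - 1) * Real.exp (-(l * s))) ∂U ≤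
        ENNReal.ofReal (C * ρ ^ δ' * (φ ρ)⁻¹) * ENNReal.ofReal (l ^ (p - δ' - 1)) := by
    intro l hl
    have hl0 : 0 < l := hl.1
    have hφl := hφ.pos l hl0
    simp_rw [ENNReal.ofReal_mul (Real.rpow_nonneg hl0.le (p - 1))]
    rw [lintegral_const_mul' _ _ ENNReal.ofReal_ne_top, hL l hl0,
      ← ENNReal.ofReal_mul (by positivity), ← ENNReal.ofReal_mul (by positivity)]
    refine ENNReal.ofReal_le_ofReal ?_
    have h1 := hs.upper l ρ hl0 hl.2
    have h2 : (φ l)⁻¹ ≤ C * (ρ / l) ^ δ' * (φ ρ)⁻¹ := by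
      rw [← div_eq_mul_inv, inv_le_iff_one_le_mul₀ hφl, div_mul_eq_mul_div, one_le_div hφρ]
      exact h1
    calc l ^ (p - 1) * (φ l)⁻¹ ≤ l ^ (p - 1) * (C * (ρ / l) ^ δ' * (φ ρ)⁻¹) := by gcongr
      _ = C * ρ ^ δ' * (φ ρ)⁻¹ * (l ^ (p - 1) / l ^ δ') := by
        rw [Real.div_rpow hρ.le hl0.le]; ring
      _ = _ := by rw [← Real.rpow_sub hl0]; ring_nf
  calc ∫⁻ s, ENNReal.ofReal ((min ρ s⁻¹) ^ p) ∂U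
      ≤ ∫⁻ s, ENNReal.ofReal (p * Real.exp 1) *
          (∫⁻ l in Ioc 0 ρ, ENNReal.ofReal (l ^ (p - 1) * Real.exp (-(l * s)))) ∂U :=
        lintegral_mono_ae (hU.mono fun s hs0 => ofReal_min_rpow_le hp hρ hs0)
    _ = ENNReal.ofReal (p * Real.exp 1) * ∫⁻ l in Ioc 0 ρ,
          (∫⁻ s, ENNReal.ofReal (l ^ (p - 1) * Real.exp (-(l * s))) ∂U) := by
        rw [lintegral_const_mul' _ _ ENNReal.ofReal_ne_top,
          lintegral_lintegral_swap hmeas.aemeasurable]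
    _ ≤ ENNReal.ofReal (p * Real.exp 1) * ∫⁻ l in Ioc 0 ρ,
          ENNReal.ofReal (C * ρ ^ δ' * (φ ρ)⁻¹) * ENNReal.ofReal (l ^ (p - δ' - 1)) := by
        exact mul_le_mul_right (setLIntegral_mono' measurableSet_Ioc hinner) _
    _ = _ := by
        rw [lintegral_const_mul' _ _ ENNReal.ofReal_ne_top, lintegral_Ioc_rpow hpd hρ.le,
          ← ENNReal.ofReal_mul (by positivity), ← ENNReal.ofReal_mul (by positivity)]
        congr 1
        rw [Real.rpow_sub hρ]
        field_simp

theorem exists_potentialDensity_le [SFinite U] (hd : 1 ≤ d) (hφ : IsCompleteBernstein φ a b m)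
    (hs : GlobalScaling φ δ δ' C) (hdim : 2 * δ' < d) (hU : ∀ᵐ s ∂U, 0 < s)
    (hL : ∀ l : ℝ, 0 < l →
      ∫⁻ s, ENNReal.ofReal (Real.exp (-(l * s))) ∂U = ENNReal.ofReal (φ l)⁻¹) :
    ∃ K : ℝ, 0 < K ∧ ∀ x : EuclideanSpace ℝ (Fin d), x ≠ 0 →
      ∫⁻ s, ENNReal.ofReal (heatKernel d s x) ∂U ≤
        ENNReal.ofReal (K * ((‖x‖ ^ d)⁻¹ * (φ ((‖x‖ ^ 2)⁻¹))⁻¹)) := by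
  have hd0 : (0 : ℝ) < (d : ℝ) / 2 := by
    have : (0 : ℝ) < d := by exact_mod_cast hd
    positivity
  have hdδ : δ' < (d : ℝ) / 2 := by linarith
  have hC := hs.const_pos
  have hpd : 0 < (d : ℝ) / 2 - δ' := sub_pos.2 hdδ
  obtain ⟨A, hA, hup⟩ := exists_heatKernel_le hd
  refine ⟨(1 + A) * ((d : ℝ) / 2 * Real.exp 1 * (C / ((d : ℝ) / 2 - δ'))), by positivity,
    fun x hx => ?_⟩
  have hr : 0 < ‖x‖ := norm_pos_iff.2 hx
  -- For `s ≤ |x|²` the bound is `|x|^(-d)`, for `s ≥ |x|²` it is `s^(-d/2)`; together they are the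
  -- truncated power with `ρ = |x|^(-2)` and `p = d/2`.
  have hpt : ∀ s : ℝ, 0 < s →
      heatKernel d s x ≤ (1 + A) * (min (‖x‖ ^ 2)⁻¹ s⁻¹) ^ ((d : ℝ) / 2) := by
    intro s hs0
    rcases le_total (‖x‖ ^ 2)⁻¹ s⁻¹ with h | h
    · rw [min_eq_left h, Real.inv_rpow (by positivity), sq_rpow_half_nat hr.le]
      refine (hup s x hs0 hx).trans ?_
      have h1 : min 1 ((‖x‖ ^ 2)⁻¹ * s) ≤ 1 := min_le_left _ _
      calc A * (‖x‖ ^ d)⁻¹ * min 1 ((‖x‖ ^ 2)⁻¹ * s) ≤ A * (‖x‖ ^ d)⁻¹ * 1 := by gcongr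
        _ ≤ (1 + A) * (‖x‖ ^ d)⁻¹ := by rw [mul_one]; gcongr; linarith
    · rw [min_eq_right h]
      refine (heatKernel_le_rpow hs0 x).trans ?_
      have : 0 < (s⁻¹) ^ ((d : ℝ) / 2) := by positivity
      nlinarith
  calc ∫⁻ s, ENNReal.ofReal (heatKernel d s x) ∂U
      ≤ ∫⁻ s, ENNReal.ofReal (1 + A) *
          ENNReal.ofReal ((min (‖x‖ ^ 2)⁻¹ s⁻¹) ^ ((d : ℝ) / 2)) ∂U := by
        refine lintegral_mono_ae (hU.mono fun s hs0 => ?_)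
        rw [← ENNReal.ofReal_mul (by positivity)]
        exact ENNReal.ofReal_le_ofReal (hpt s hs0)
    _ ≤ ENNReal.ofReal (1 + A) * ENNReal.ofReal (_ * (_ * _)) := by
        rw [lintegral_const_mul' _ _ ENNReal.ofReal_ne_top]
        gcongr
        exact lintegral_min_rpow_le hφ hs hU hL hd0 hdδ (by positivity)
    _ = _ := by
        rw [← ENNReal.ofReal_mul (by positivity), Real.inv_rpow (by positivity),
          sq_rpow_half_nat hr.le, mul_assoc (1 + A)]

/-- Only times `s` between `ε |x|²` and `14 |x|²` are kept. The Laplace transform at `|x|^(-2)`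
loses at most half of its mass outside this range, and inside it the kernel is at least of order
`|x|^(-d)`. -/
theorem exists_le_potentialDensity (hφ : IsCompleteBernstein φ a b m)
    (hs : GlobalScaling φ δ δ' C) (hU : ∀ᵐ s ∂U, 0 < s)
    (hL : ∀ l : ℝ, 0 < l →
      ∫⁻ s, ENNReal.ofReal (Real.exp (-(l * s))) ∂U = ENNReal.ofReal (φ l)⁻¹) :
    ∃ k : ℝ, 0 < k ∧ ∀ x : EuclideanSpace ℝ (Fin d), x ≠ 0 →
      ENNReal.ofReal (k * ((‖x‖ ^ d)⁻¹ * (φ ((‖x‖ ^ 2)⁻¹))⁻¹)) ≤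
        ∫⁻ s, ENNReal.ofReal (heatKernel d s x) ∂U := by
  have hpi := Real.pi_pos
  have hC := hs.const_pos
  obtain ⟨ε, hε0, hε1, hε⟩ := exists_rpow_small (C := Real.exp 1 * C) (η := 1 / 4)
    hs.lower_exponent_pos (by norm_num)
  -- The cut-off 14 is chosen so that `exp(-s/R) ≤ exp(-7) exp(-s/(2R))` for `s ≥ 14 R`, where `R =
  -- |x|²`; then `exp(-7) ≤ 1/8` beats the doubling factor 2 of `φ`.
  set k := (4 * Real.pi * 14) ^ (-((d : ℝ) / 2)) * Real.exp (-(4 * ε)⁻¹) with hk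
  have hk0 : 0 < k := by positivity
  refine ⟨k / 2, by positivity, fun x hx => ?_⟩
  have hr : 0 < ‖x‖ := norm_pos_iff.2 hx
  set R := ‖x‖ ^ 2 with hR
  have hR0 : 0 < R := by positivity
  have hφR := hφ.pos R⁻¹ (by positivity)
  have hφε := hφ.pos (ε * R)⁻¹ (by positivity)
  have hφ2 := hφ.pos (2 * R)⁻¹ (by positivity)
  have hpt : ∀ s : ℝ, 0 < s → Real.exp (-(R⁻¹ * s)) ≤ k⁻¹ * ‖x‖ ^ d * heatKernel d s x +
      Real.exp 1 * Real.exp (-((ε * R)⁻¹ * s)) +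
      Real.exp (-7) * Real.exp (-((2 * R)⁻¹ * s)) := by
    intro s hs0
    have hq := heatKernel_nonneg hs0.le x
    have hq0 : 0 ≤ k⁻¹ * ‖x‖ ^ d * heatKernel d s x := by positivity
    have hle1 : Real.exp (-(R⁻¹ * s)) ≤ 1 := Real.exp_le_one_iff.2 (neg_nonpos.2 (by positivity))
    have h2 := Real.exp_pos 1
    have h3 := Real.exp_pos (-((ε * R)⁻¹ * s))
    have h4 := Real.exp_pos (-((2 * R)⁻¹ * s))
    have h5 := Real.exp_pos (-7)
    rcases le_or_gt s (ε * R) with c1 | c1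
    · have : 1 ≤ Real.exp 1 * Real.exp (-((ε * R)⁻¹ * s)) := by
        rw [← Real.exp_add]
        refine Real.one_le_exp ?_
        have : (ε * R)⁻¹ * s ≤ 1 := by rw [inv_mul_le_iff₀ (by positivity)]; linarith
        linarith
      nlinarith [mul_pos h5 h4]
    rcases le_or_gt s (14 * R) with c2 | c2
    · have h6 : k * (‖x‖ ^ d)⁻¹ ≤ heatKernel d s x := heatKernel_ge hε0 hx c1.le c2
      have : 1 ≤ k⁻¹ * ‖x‖ ^ d * heatKernel d s x := by
        calc (1 : ℝ) = k⁻¹ * ‖x‖ ^ d * (k * (‖x‖ ^ d)⁻¹) := by field_simp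
          _ ≤ _ := by gcongr
      nlinarith [mul_pos h5 h4, mul_pos h2 h3]
    · have : Real.exp (-(R⁻¹ * s)) ≤ Real.exp (-7) * Real.exp (-((2 * R)⁻¹ * s)) := by
        rw [← Real.exp_add]
        refine Real.exp_le_exp.2 ?_
        have e : R⁻¹ * s = (2 * R)⁻¹ * s + (2 * R)⁻¹ * s := by field_simp; ring
        have : 7 ≤ (2 * R)⁻¹ * s := by
          rw [le_inv_mul_iff₀ (by positivity)]; linarith
        linarith
      nlinarith [mul_pos h2 h3]
  have hv1 : Real.exp 1 * (φ (ε * R)⁻¹)⁻¹ ≤ 1 / 4 * (φ R⁻¹)⁻¹ := by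
    have h1 := hs.lower R⁻¹ (ε * R)⁻¹ (by positivity)
      (inv_anti₀ (by positivity) (by nlinarith))
    have e : R⁻¹ / (ε * R)⁻¹ = ε := by field_simp
    rw [e] at h1
    rw [← div_eq_mul_inv, ← div_eq_mul_inv, div_le_div_iff₀ hφε hφR]
    calc Real.exp 1 * φ R⁻¹ ≤ Real.exp 1 * (C * ε ^ δ * φ (ε * R)⁻¹) := by gcongr
      _ = (Real.exp 1 * C * ε ^ δ) * φ (ε * R)⁻¹ := by ring
      _ ≤ _ := by gcongr
  have hv2 : Real.exp (-7) * (φ (2 * R)⁻¹)⁻¹ ≤ 1 / 4 * (φ R⁻¹)⁻¹ := by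
    have h1 := hφ.map_mul_le (c := 2) (x := (2 * R)⁻¹) (by norm_num) (by positivity)
    have e : 2 * (2 * R)⁻¹ = R⁻¹ := by field_simp
    rw [e] at h1
    have h2 : Real.exp (-7) ≤ 1 / 8 := by
      rw [Real.exp_neg, ← one_div]
      exact one_div_le_one_div_of_le (by norm_num) (by linarith [Real.add_one_le_exp 7])
    rw [← div_eq_mul_inv, ← div_eq_mul_inv, div_le_div_iff₀ hφ2 hφR]
    calc Real.exp (-7) * φ R⁻¹ ≤ 1 / 8 * (2 * φ (2 * R)⁻¹) := by gcongr
      _ = _ := by ring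
  set G := ∫⁻ s, ENNReal.ofReal (heatKernel d s x) ∂U with hG
  have hmain : ENNReal.ofReal (φ R⁻¹)⁻¹ ≤ ENNReal.ofReal (k⁻¹ * ‖x‖ ^ d) * G +
      ENNReal.ofReal (1 / 2 * (φ R⁻¹)⁻¹) := by
    calc ENNReal.ofReal (φ R⁻¹)⁻¹
        = ∫⁻ s, ENNReal.ofReal (Real.exp (-(R⁻¹ * s))) ∂U := (hL _ (by positivity)).symm
      _ ≤ ∫⁻ s, (ENNReal.ofReal (k⁻¹ * ‖x‖ ^ d) * ENNReal.ofReal (heatKernel d s x) +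
            ENNReal.ofReal (Real.exp 1) * ENNReal.ofReal (Real.exp (-((ε * R)⁻¹ * s))) +
            ENNReal.ofReal (Real.exp (-7)) *
              ENNReal.ofReal (Real.exp (-((2 * R)⁻¹ * s)))) ∂U := by
          refine lintegral_mono_ae (hU.mono fun s hs0 => ?_)
          have hq := heatKernel_nonneg hs0.le x
          rw [← ENNReal.ofReal_mul (by positivity), ← ENNReal.ofReal_mul (by positivity),
            ← ENNReal.ofReal_mul (by positivity), ← ENNReal.ofReal_add (by positivity)
              (by positivity), ← ENNReal.ofReal_add (by positivity) (by positivity)]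
          exact ENNReal.ofReal_le_ofReal (hpt s hs0)
      _ = ENNReal.ofReal (k⁻¹ * ‖x‖ ^ d) * G +
            ENNReal.ofReal (Real.exp 1) * ENNReal.ofReal (φ (ε * R)⁻¹)⁻¹ +
            ENNReal.ofReal (Real.exp (-7)) * ENNReal.ofReal (φ (2 * R)⁻¹)⁻¹ := by
          rw [lintegral_add_right _ (by fun_prop), lintegral_add_right _ (by fun_prop),
            lintegral_const_mul' _ _ ENNReal.ofReal_ne_top,
            lintegral_const_mul' _ _ ENNReal.ofReal_ne_top,
            lintegral_const_mul' _ _ ENNReal.ofReal_ne_top, hL _ (by positivity),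
            hL _ (by positivity)]
      _ ≤ _ := by
          rw [add_assoc, ← ENNReal.ofReal_mul (by positivity),
            ← ENNReal.ofReal_mul (by positivity),
            ← ENNReal.ofReal_add (by positivity) (by positivity)]
          gcongr
          linarith
  -- The error term is finite and half of the left side, so it can be cancelled in `ℝ≥0∞`.
  have e : (φ R⁻¹)⁻¹ = 1 / 2 * (φ R⁻¹)⁻¹ + 1 / 2 * (φ R⁻¹)⁻¹ := by ring
  rw [e, ENNReal.ofReal_add (by positivity) (by positivity), ← e,
    ENNReal.add_le_add_iff_right ENNReal.ofReal_ne_top] at hmain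
  calc ENNReal.ofReal (k / 2 * ((‖x‖ ^ d)⁻¹ * (φ R⁻¹)⁻¹))
      = ENNReal.ofReal (k * (‖x‖ ^ d)⁻¹) * ENNReal.ofReal (1 / 2 * (φ R⁻¹)⁻¹) := by
        rw [← ENNReal.ofReal_mul (by positivity)]; ring_nf
    _ ≤ ENNReal.ofReal (k * (‖x‖ ^ d)⁻¹) * (ENNReal.ofReal (k⁻¹ * ‖x‖ ^ d) * G) := by gcongr
    _ = G := by
        rw [← mul_assoc, ← ENNReal.ofReal_mul (by positivity)]
        have : k * (‖x‖ ^ d)⁻¹ * (k⁻¹ * ‖x‖ ^ d) = 1 := by field_simp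
        rw [this, ENNReal.ofReal_one, one_mul]

theorem comparable_potentialDensity [SFinite U] (hd : 1 ≤ d) (hφ : IsCompleteBernstein φ a b m)
    (hs : GlobalScaling φ δ δ' C) (hdim : 2 * δ' < d) (hU : ∀ᵐ s ∂U, 0 < s)
    (hL : ∀ l : ℝ, 0 < l →
      ∫⁻ s, ENNReal.ofReal (Real.exp (-(l * s))) ∂U = ENNReal.ofReal (φ l)⁻¹) :
    ComparableOffZero (fun x : EuclideanSpace ℝ (Fin d) =>
        ∫⁻ s, ENNReal.ofReal (heatKernel d s x) ∂U)
      (fun x => (‖x‖ ^ d)⁻¹ * (φ ((‖x‖ ^ 2)⁻¹))⁻¹) := by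
  obtain ⟨K, hK, hup⟩ := exists_potentialDensity_le hd hφ hs hdim hU hL
  obtain ⟨k, hk, hlow⟩ := exists_le_potentialDensity (d := d) hφ hs hU hL
  refine ⟨max 1 (max K k⁻¹), le_max_left _ _, fun x hx => ?_⟩
  have hr : 0 < ‖x‖ := norm_pos_iff.2 hx
  have := hφ.pos (‖x‖ ^ 2)⁻¹ (by positivity)
  constructor
  · refine le_trans (ENNReal.ofReal_le_ofReal ?_) (hlow x hx)
    gcongr
    refine inv_le_of_inv_le₀ (by positivity) ?_
    exact (le_max_right _ _).trans (le_max_right _ _)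
  · refine (hup x hx).trans (ENNReal.ofReal_le_ofReal ?_)
    gcongr
    exact (le_max_left _ _).trans (le_max_right _ _)

lemma measurable_heatKernel_left (x : EuclideanSpace ℝ (Fin d)) :
    Measurable fun s => ENNReal.ofReal (heatKernel d s x) :=
  (measurable_heatKernel.comp (measurable_id.prodMk measurable_const)).ennreal_ofReal

/-- A Gaussian gives `A` mass at most 1 and at most `s^(-d/2)` times its volume. This is a truncated
power with `ρ = 1`, whose `U`-integral is finite. -/
theorem setLIntegral_potentialDensity_lt_top [SFinite U] (hd : 1 ≤ d)
    (hφ : IsCompleteBernstein φ a b m)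
    (hs : GlobalScaling φ δ δ' C) (hdim : 2 * δ' < d) (hU : ∀ᵐ s ∂U, 0 < s)
    (hL : ∀ l : ℝ, 0 < l →
      ∫⁻ s, ENNReal.ofReal (Real.exp (-(l * s))) ∂U = ENNReal.ofReal (φ l)⁻¹)
    {A : Set (EuclideanSpace ℝ (Fin d))} (hA : volume A ≠ ∞) :
    ∫⁻ x in A, ∫⁻ s, ENNReal.ofReal (heatKernel d s x) ∂U < ∞ := by
  have hd0 : (0 : ℝ) < (d : ℝ) / 2 := by
    have : (0 : ℝ) < d := by exact_mod_cast hd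
    positivity
  have hswap : Measurable fun p : EuclideanSpace ℝ (Fin d) × ℝ =>
      ENNReal.ofReal (heatKernel d p.2 p.1) :=
    (measurable_heatKernel.comp measurable_swap).ennreal_ofReal
  rw [lintegral_lintegral_swap hswap.aemeasurable]
  have hpt : ∀ s : ℝ, 0 < s → ∫⁻ x in A, ENNReal.ofReal (heatKernel d s x) ≤
      (1 + volume A) * ENNReal.ofReal ((min 1 s⁻¹) ^ ((d : ℝ) / 2)) := by
    intro s hs0
    rcases le_total 1 s⁻¹ with h | h
    · rw [min_eq_left h, Real.one_rpow, ENNReal.ofReal_one, mul_one]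
      refine (setLIntegral_le_lintegral _ _).trans ?_
      rw [lintegral_heatKernel hs0]
      exact le_self_add
    · rw [min_eq_right h]
      calc ∫⁻ x in A, ENNReal.ofReal (heatKernel d s x)
          ≤ ∫⁻ _ in A, ENNReal.ofReal ((s⁻¹) ^ ((d : ℝ) / 2)) :=
            lintegral_mono fun x => ENNReal.ofReal_le_ofReal (heatKernel_le_rpow hs0 x)
        _ = volume A * ENNReal.ofReal ((s⁻¹) ^ ((d : ℝ) / 2)) := by
            rw [setLIntegral_const, mul_comm]
        _ ≤ _ := by gcongr; exact le_add_self
  have hc : 1 + volume A ≠ ∞ := ENNReal.add_ne_top.2 ⟨ENNReal.one_ne_top, hA⟩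
  refine (lintegral_mono_ae (hU.mono hpt)).trans_lt ?_
  rw [lintegral_const_mul' _ _ hc]
  exact ENNReal.mul_lt_top hc.lt_top
    ((lintegral_min_rpow_le hφ hs hU hL hd0 (by linarith) one_pos).trans_lt
      ENNReal.ofReal_lt_top)

end Potential

/-! ### The potential measure of the subordinator and the Green function -/

section Green

variable {Ω : Type*} [MeasurableSpace Ω] {P : Measure Ω}
  {d : ℕ} {φ m : ℝ → ℝ} {a b δ δ' C : ℝ} {S S' : ℝ≥0 → Ω → ℝ≥0}
  {W : ℝ≥0 → Ω → EuclideanSpace ℝ (Fin d)}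

/-- The mean occupation measure of a nonnegative process. -/
noncomputable def potentialMeasure (P : Measure Ω) (S : ℝ≥0 → Ω → ℝ≥0) : Measure ℝ :=
  ((volume.restrict (Ioi (0 : ℝ))).prod P).map fun p => (S p.1.toNNReal p.2 : ℝ)

lemma measurable_uncurry_toNNReal {F : Type*} [MeasurableSpace F] {X : ℝ≥0 → Ω → F}
    (hX : Measurable (Function.uncurry X)) :
    Measurable fun p : ℝ × Ω => X p.1.toNNReal p.2 := by
  have h : Measurable fun p : ℝ × Ω => (p.1.toNNReal, p.2) := by fun_prop
  simpa only [Function.comp_def, Function.uncurry] using hX.comp h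

instance [SFinite P] : SFinite (potentialMeasure P S) := by
  unfold potentialMeasure; infer_instance

lemma lintegral_potentialMeasure [SFinite P] (hS' : Measurable (Function.uncurry S'))
    {f : ℝ → ℝ≥0∞} (hf : Measurable f) :
    ∫⁻ s, f s ∂potentialMeasure P S' =
      ∫⁻ t in Ioi (0 : ℝ), ∫⁻ ω, f (S' t.toNNReal ω) ∂P := by
  have h : Measurable fun p : ℝ × Ω => (S' p.1.toNNReal p.2 : ℝ) :=
    (measurable_uncurry_toNNReal hS').coe_nnreal_real
  have hfh : Measurable fun p : ℝ × Ω => f (S' p.1.toNNReal p.2) := hf.comp h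
  rw [potentialMeasure, lintegral_map hf h, lintegral_prod _ hfh.aemeasurable]

lemma lintegral_exp_neg_mul_Ioi {c : ℝ} (hc : 0 < c) :
    ∫⁻ t in Ioi (0 : ℝ), ENNReal.ofReal (Real.exp (-(t * c))) = ENNReal.ofReal c⁻¹ := by
  have h1 := integrableOn_exp_mul_Ioi (neg_lt_zero.2 hc) 0
  have h2 := integral_exp_mul_Ioi (neg_lt_zero.2 hc) 0
  have e : ∀ t : ℝ, -(t * c) = -c * t := fun t => by ring
  simp_rw [e]
  rw [← ofReal_integral_eq_lintegral_ofReal h1 (Eventually.of_forall fun t => (Real.exp_pos _).le),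
    h2]
  simp

/-- Tonelli leaves the time integral of `exp(-t φ(l))`. -/
lemma lintegral_exp_potentialMeasure [IsProbabilityMeasure P]
    (hS : IsSubordinator P S φ) (hS' : Measurable (Function.uncurry S'))
    (hSS' : ∀ᵐ ω ∂P, ∀ t, S' t ω = S t ω) {l : ℝ} (hl : 0 < l) (hφl : 0 < φ l) :
    ∫⁻ s, ENNReal.ofReal (Real.exp (-(l * s))) ∂potentialMeasure P S' =
      ENNReal.ofReal (φ l)⁻¹ := by
  rw [lintegral_potentialMeasure hS' (by fun_prop), ← lintegral_exp_neg_mul_Ioi hφl]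
  refine setLIntegral_congr_fun measurableSet_Ioi fun t (ht : 0 < t) => ?_
  have hm := hS.measurable t.toNNReal
  have hexp : Measurable fun ω => Real.exp (-(l * (S t.toNNReal ω : ℝ))) := by fun_prop
  have h := hS.laplace t.toNNReal l hl
  rw [Real.coe_toNNReal t ht.le] at h
  rw [← h, ofReal_integral_eq_lintegral_ofReal
    ((integrable_const (1 : ℝ)).mono' hexp.aestronglyMeasurable
      (Eventually.of_forall fun ω => ?_)) (Eventually.of_forall fun ω => (Real.exp_pos _).le)]
  · exact lintegral_congr_ae (hSS'.mono fun ω hω => by simp only [hω])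
  · rw [Real.norm_of_nonneg (Real.exp_pos _).le]
    exact Real.exp_le_one_iff.2 (neg_nonpos.2 (by positivity))

lemma ae_pos_potentialMeasure [IsProbabilityMeasure P]
    (hφ : IsCompleteBernstein φ a b m) (hs : GlobalScaling φ δ δ' C)
    (hS : IsSubordinator P S φ) (hS' : Measurable (Function.uncurry S'))
    (hSS' : ∀ᵐ ω ∂P, ∀ t, S' t ω = S t ω) : ∀ᵐ s ∂potentialMeasure P S', 0 < s := by
  have h : potentialMeasure P S' (Iic 0) = 0 := by
    rw [← lintegral_indicator_one measurableSet_Iic,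
      lintegral_potentialMeasure hS' (measurable_one.indicator measurableSet_Iic),
      setLIntegral_congr_fun (g := fun _ => 0) measurableSet_Ioi, lintegral_zero]
    intro t (ht : 0 < t)
    refine lintegral_eq_zero_of_ae_eq_zero ?_
    filter_upwards [hSS', hS.ae_pos hφ hs (Real.toNNReal_pos.2 ht)] with ω h1 h2
    rw [h1, indicator_of_notMem (by simpa using h2)]
    rfl
  filter_upwards [measure_eq_zero_iff_ae_notMem.1 h] with s hs0
  simpa using hs0

lemma transitionDensity_eq [IsProbabilityMeasure P]
    (hφ : IsCompleteBernstein φ a b m) (hs : GlobalScaling φ δ δ' C)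
    (hS : IsSubordinator P S φ) (hSS' : ∀ᵐ ω ∂P, ∀ t, S' t ω = S t ω)
    {t : ℝ≥0} (ht : 0 < t) (x : EuclideanSpace ℝ (Fin d)) :
    transitionDensity d P S t x = ∫⁻ ω, ENNReal.ofReal (heatKernel d (S' t ω) x) ∂P := by
  have hmS : Measurable fun ω => (S t ω : ℝ) := hS.levy.measurable t
  rw [transitionDensity, ← lintegral_indicator measurableSet_Ioi,
    lintegral_map ((measurable_heatKernel_left x).indicator measurableSet_Ioi) hmS]
  refine lintegral_congr_ae ?_
  filter_upwards [hSS', hS.ae_pos hφ hs ht] with ω h1 h2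
  rw [h1, indicator_of_mem (by simpa using h2)]

lemma greenFunction_eq [IsProbabilityMeasure P]
    (hφ : IsCompleteBernstein φ a b m) (hs : GlobalScaling φ δ δ' C)
    (hS : IsSubordinator P S φ) (hS' : Measurable (Function.uncurry S'))
    (hSS' : ∀ᵐ ω ∂P, ∀ t, S' t ω = S t ω) :
    greenFunction d P S = fun x =>
      ∫⁻ s, ENNReal.ofReal (heatKernel d s x) ∂potentialMeasure P S' := by
  funext x
  rw [greenFunction, lintegral_potentialMeasure hS' (measurable_heatKernel_left x)]
  exact setLIntegral_congr_fun measurableSet_Ioi fun t (ht : 0 < t) =>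
    transitionDensity_eq hφ hs hS hSS' (Real.toNNReal_pos.2 ht) x

lemma meanOccupationTime_eq_lintegral {E : Type*} [MeasurableSpace E] [SFinite P]
    {X Y : ℝ≥0 → Ω → E} (hY : Measurable (Function.uncurry Y))
    (hXY : ∀ᵐ ω ∂P, ∀ t, Y t ω = X t ω) {A : Set E} (hA : MeasurableSet A) :
    meanOccupationTime P X A =
      ∫⁻ t in Ioi (0 : ℝ), P {ω | Y t.toNNReal ω ∈ A} := by
  have hYA : MeasurableSet {p : ℝ × Ω | Y p.1.toNNReal p.2 ∈ A} :=
    measurable_uncurry_toNNReal hY hA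
  have h1 : meanOccupationTime P X A =
      ∫⁻ ω, (volume.restrict (Ioi (0 : ℝ))) {t | Y t.toNNReal ω ∈ A} ∂P := by
    refine lintegral_congr_ae (hXY.mono fun ω hω => ?_)
    have hm : MeasurableSet {t : ℝ | Y t.toNNReal ω ∈ A} :=
      (measurable_prodMk_right : Measurable fun t : ℝ => (t, ω)) hYA
    simp only [← hω]
    -- Occupation time counts `t = 0` as well; that single instant is null.
    rw [← Measure.restrict_congr_set (Ioi_ae_eq_Ici (a := (0 : ℝ))).symm,
      Measure.restrict_apply hm]
    congr 1
    ext t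
    simp [and_comm]
  rw [h1]
  calc _ = ((volume.restrict (Ioi (0 : ℝ))).prod P) {p | Y p.1.toNNReal p.2 ∈ A} :=
        (Measure.prod_apply_symm hYA).symm
    _ = _ := Measure.prod_apply hYA

theorem meanOccupationTime_subordinate [IsProbabilityMeasure P]
    (hφ : IsCompleteBernstein φ a b m) (hs : GlobalScaling φ δ δ' C)
    (hS : IsSubordinator P S φ) (hW : IsBrownianMotion P W)
    (hSW : IndepFun (fun ω t => S t ω) (fun ω t => W t ω) P)
    {A : Set (EuclideanSpace ℝ (Fin d))} (hA : MeasurableSet A) :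
    meanOccupationTime P (subordinate W S) A = ∫⁻ x in A, greenFunction d P S x := by
  obtain ⟨S', hS', hSS'⟩ := hS.exists_version
  obtain ⟨X, hX, hXX'⟩ := exists_subordinate_version hS hW
  have hmeas : Measurable fun q : (ℝ × EuclideanSpace ℝ (Fin d)) × Ω =>
      ENNReal.ofReal (heatKernel d (S' q.1.1.toNNReal q.2) q.1.2) := by
    have h1 : Measurable fun q : (ℝ × EuclideanSpace ℝ (Fin d)) × Ω => (q.1.1, q.2) := by fun_prop
    have h2 : Measurable fun q : (ℝ × EuclideanSpace ℝ (Fin d)) × Ω =>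
        (S' q.1.1.toNNReal q.2 : ℝ) := ((measurable_uncurry_toNNReal hS').comp h1).coe_nnreal_real
    have h3 : Measurable fun q : (ℝ × EuclideanSpace ℝ (Fin d)) × Ω => q.1.2 := by fun_prop
    exact (measurable_heatKernel.comp (h2.prodMk h3)).ennreal_ofReal
  have hp : Measurable fun q : ℝ × EuclideanSpace ℝ (Fin d) =>
      ∫⁻ ω, ENNReal.ofReal (heatKernel d (S' q.1.toNNReal ω) q.2) ∂P :=
    hmeas.lintegral_prod_right'
  calc meanOccupationTime P (subordinate W S) A
      = ∫⁻ t in Ioi (0 : ℝ), P {ω | X t.toNNReal ω ∈ A} :=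
        meanOccupationTime_eq_lintegral hX hXX' hA
    _ = ∫⁻ t in Ioi (0 : ℝ), ∫⁻ x in A,
          (∫⁻ ω, ENNReal.ofReal (heatKernel d (S' t.toNNReal ω) x) ∂P) := by
        refine setLIntegral_congr_fun measurableSet_Ioi fun t (ht : 0 < t) => ?_
        have ht' := Real.toNNReal_pos.2 ht
        have hXt : Measurable (X t.toNNReal) := hX.comp measurable_prodMk_left
        have h1 : P.map (X t.toNNReal) = P.map (subordinate W S t.toNNReal) :=
          Measure.map_congr (hXX'.mono fun ω hω => hω _)
        have h2 : P {ω | X t.toNNReal ω ∈ A} = P.map (X t.toNNReal) A :=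
          (Measure.map_apply hXt hA).symm
        rw [h2, h1, map_subordinate_eq hφ hs hS hW hSW ht', withDensity_apply _ hA]
        exact lintegral_congr fun x => transitionDensity_eq hφ hs hS hSS' ht' x
    _ = ∫⁻ x in A, ∫⁻ t in Ioi (0 : ℝ),
          (∫⁻ ω, ENNReal.ofReal (heatKernel d (S' t.toNNReal ω) x) ∂P) :=
        lintegral_lintegral_swap hp.aemeasurable
    _ = ∫⁻ x in A, greenFunction d P S x := by
        refine lintegral_congr fun x => ?_
        exact setLIntegral_congr_fun measurableSet_Ioi fun t (ht : 0 < t) =>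
          (transitionDensity_eq hφ hs hS hSS' (Real.toNNReal_pos.2 ht) x).symm

end Green

end SubBM

theorem theorem3p4 {Ω : Type*} [MeasurableSpace Ω] (P : Measure Ω) [IsProbabilityMeasure P]
    (d : ℕ) (hd : 1 ≤ d)
    (φ : ℝ → ℝ) (a b : ℝ) (m : ℝ → ℝ) (hφ : SubBM.IsCompleteBernstein φ a b m)
    (δ₁ δ₂ δ₃ δ₄ a₁ a₂ a₃ a₄ : ℝ)
    (H1 : SubBM.ScalingAtInfinity φ δ₁ δ₂ a₁ a₂)
    (H2 : SubBM.ScalingAtZero φ δ₃ δ₄ a₃ a₄)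
    (S : ℝ≥0 → Ω → ℝ≥0) (hS : SubBM.IsSubordinator P S φ)
    (W : ℝ≥0 → Ω → EuclideanSpace ℝ (Fin d)) (hW : SubBM.IsBrownianMotion P W)
    (hSW : IndepFun (fun ω t => S t ω) (fun ω t => W t ω) P) :
    (SubBM.IsLevyMeasure P (SubBM.subordinate W S)
        (volume.withDensity (SubBM.jumpDensity d m)) ∧
      SubBM.ComparableOffZero (SubBM.jumpDensity d m)
        (fun x => (‖x‖ ^ d)⁻¹ * φ ((‖x‖ ^ 2)⁻¹))) ∧
    (2 * max δ₂ δ₄ < (d : ℝ) →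
      SubBM.IsTransient P (SubBM.subordinate W S) ∧
      (∀ A : Set (EuclideanSpace ℝ (Fin d)), MeasurableSet A →
        SubBM.meanOccupationTime P (SubBM.subordinate W S) A =
          ∫⁻ x in A, SubBM.greenFunction d P S x) ∧
      SubBM.ComparableOffZero (SubBM.greenFunction d P S)
        (fun x => (‖x‖ ^ d)⁻¹ * (φ ((‖x‖ ^ 2)⁻¹))⁻¹)) := by
  obtain ⟨δ, C, hs⟩ := SubBM.exists_globalScaling hφ.pos H1 H2
  refine ⟨⟨SubBM.isLevyMeasure_jumpDensity hd hφ hs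
    (fun t ξ hξ => SubBM.charFun_subordinate_of_ne_zero hS hW hSW t ξ hξ)
    (SubBM.charFun_subordinate_zero hS hW hSW), SubBM.comparable_jumpDensity hd hφ hs⟩,
    fun hdim => ?_⟩
  -- A jointly measurable version is needed for the potential measure to be a genuine pushforward;
  -- it has the same paths almost surely.
  obtain ⟨S', hS', hSS'⟩ := hS.exists_version
  have hU := SubBM.ae_pos_potentialMeasure hφ hs hS hS' hSS'
  have hL : ∀ l : ℝ, 0 < l → ∫⁻ s, ENNReal.ofReal (Real.exp (-(l * s)))
      ∂SubBM.potentialMeasure P S' = ENNReal.ofReal (φ l)⁻¹ := fun l hl =>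
    SubBM.lintegral_exp_potentialMeasure hS hS' hSS' hl (hφ.pos l hl)
  have hG := SubBM.greenFunction_eq (d := d) hφ hs hS hS' hSS'
  have hocc := fun (A : Set (EuclideanSpace ℝ (Fin d))) (hA : MeasurableSet A) =>
    SubBM.meanOccupationTime_subordinate hφ hs hS hW hSW hA
  refine ⟨fun K hK => ?_, hocc, ?_⟩
  · rw [hocc K hK.measurableSet, hG]
    exact SubBM.setLIntegral_potentialDensity_lt_top hd hφ hs hdim hU hL hK.measure_lt_top.ne
  · rw [hG]
    exact SubBM.comparable_potentialDensity hd hφ hs hdim hU hL
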